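/- **Theorem (SGD+WD).** Let $\Gamma$ be a measurable space with a probability measure $\nu$, and for each $\gamma\in\Gamma$ let $L_\gamma:\mathbb R^d\setminus\{0\}\to\mathbb R$ be differentiable and scale invariant, i.e. $L_\gamma(cx)=L_\gamma(x)$ for all $c>0$, $x\ne0$; let $\gamma\mapsto L_\gamma(x)$ be measurable and $\nu$-integrable for each $x\neq 0$. Put $L(x)=\mathbb E_{\gamma\sim\nu}L_\gamma(x)$ and assume that $L$ is $C^2$ on $\mathbb R^d\setminus\{0\}$. Let $\rho=\max_{\|x\|_2=1}\|\nabla^2L(x)\|$ (operator norm), assume that $M:=\sup_{\gamma\in\Gamma}\sup_{\|x\|_2=1}\|\nabla L_\gamma(x)\|_2$ is finite, and let $\underline\sigma,\overline\sigma\ge0$ satisfy $$\underline\sigma^2\le\mathbb E_{\gamma\sim\nu}\|\nabla L_\gamma(x)\|_2^2\le\overline\sigma^2\qquad\text{for all }\|x\|_2=1.$$ Let $\eta,\lambda,\delta>0$, $x(0)\in\mathbb R^d\setminus\{0\}$, let $\gamma_0,\gamma_1,\dots$ be i.i.d. with law $\nu$, and let $$x(t+1)=(1-\eta\lambda)x(t)-\eta\nabla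 L_{\gamma_t}(x(t)),\qquad t\ge0.$$ Write $\overline x=x/\|x\|_2$ and $$T_1=\left\lceil\frac1{4\eta\lambda}\max\left\{\ln\frac{M^2\eta\lambda}{\overline\sigma^2}+\left|\ln\frac{2e^4M^2}{\|x(0)\|_2^4\,\eta^{-2}}\right|+8,\ 8\right\}\right\rceil .$$ Suppose that $\eta\lambda\le0.1$, that $T>T_1$ is an integer, and that $$\frac{\underline\sigma^2}{M^2}\ge3e^{4\eta\lambda}\sqrt{\lambda\eta\ln\frac{2T^2}{\delta}} .$$ Then with probability at least $1-5\delta$ both of the following hold: (i) for all integers $T_1\le t\le T-1$, $$\frac{\underline\sigma^2}2\le\frac{2\lambda}{\eta}\|x(t)\|_2^4\le4\overline\sigma^2;$$ (ii) $$\frac1{T-T_1}\sum_{t=T_1}^{T-1}\|\nabla L(\overline x(t))\|_2^2\le\frac{\pi^2\rho\,\overline\sigma}{(T-T_1)\sqrt{2\eta\lambda}}+4\sqrt{\eta\lambda}\,\frac{\rho\,\overline\sigma^3}{\underline\sigma^2}+\sqrt{\frac{\ln\frac2\delta}{T-T_1}}\;\frac{4\pi\rho M\overline\sigma}{\underline\sigma}+\sqrt{\frac{\ln\frac2\delta}{T-T_1}}\;4\sqrt{\lambda\eta}\,\frac{M^2\rho\,\overline\sigma}{\underline\sigma^2}.$$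 -/

import Mathlib

open MeasureTheory ProbabilityTheory

noncomputable section

namespace SGDWD

/-- Scale invariance (0-homogeneity) of a function on `ℝ^d \ {0}`. Functions on `ℝ^d \ {0}` are
represented by total functions whose value at `0` is never used. -/
def IsScaleInvariant {d : ℕ} (f : EuclideanSpace ℝ (Fin d) → ℝ) : Prop :=
  ∀ c : ℝ, 0 < c → ∀ x : EuclideanSpace ℝ (Fin d), x ≠ 0 → f (c • x) = f x

/-- The direction `x / ‖x‖` of a vector `x`. -/
def direction {d : ℕ} (x : EuclideanSpace ℝ (Fin d)) : EuclideanSpace ℝ (Fin d) :=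
  ‖x‖⁻¹ • x

/-- The expected loss `L(x) = E_{g ∼ ν} ℓ_g(x)`. -/
def expectedLoss {d : ℕ} {Γ : Type*} [MeasurableSpace Γ] (ν : Measure Γ)
    (ℓ : Γ → EuclideanSpace ℝ (Fin d) → ℝ) (x : EuclideanSpace ℝ (Fin d)) : ℝ :=
  ∫ g, ℓ g x ∂ν

/-- The norm of the stochastic gradient `∇ ℓ_g (x)` at a point of the unit sphere, as a function of
the index `g` and the point `x`. -/
def sphereGradNorm {d : ℕ} {Γ : Type*} (ℓ : Γ → EuclideanSpace ℝ (Fin d) → ℝ)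
    (p : Γ × Metric.sphere (0 : EuclideanSpace ℝ (Fin d)) 1) : ℝ :=
  ‖gradient (ℓ p.1) (p.2 : EuclideanSpace ℝ (Fin d))‖

/-- `M`, the supremum of the stochastic gradient norms over all indices and the unit sphere. -/
def maxGradNorm {d : ℕ} {Γ : Type*} (ℓ : Γ → EuclideanSpace ℝ (Fin d) → ℝ) : ℝ :=
  ⨆ p : Γ × Metric.sphere (0 : EuclideanSpace ℝ (Fin d)) 1, sphereGradNorm ℓ p

/-- `ρ`, the maximum over the unit sphere of the operator norm of the Hessian of `L` (the
derivative of the gradient). -/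
def hessianBound {d : ℕ} (L : EuclideanSpace ℝ (Fin d) → ℝ) : ℝ :=
  ⨆ x : Metric.sphere (0 : EuclideanSpace ℝ (Fin d)) 1,
    ‖fderiv ℝ (gradient L) (x : EuclideanSpace ℝ (Fin d))‖

/-- The iterates of SGD with learning rate `η`, weight decay `lam` and samples `s 0, s 1, …`:
`x(t+1) = (1 - η lam) x(t) - η ∇ ℓ_{s t} (x(t))`. -/
def sgdIterate {d : ℕ} {Γ : Type*} (ℓ : Γ → EuclideanSpace ℝ (Fin d) → ℝ) (η lam : ℝ)
    (x₀ : EuclideanSpace ℝ (Fin d)) (s : ℕ → Γ) : ℕ → EuclideanSpace ℝ (Fin d)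
  | 0 => x₀
  | t + 1 => (1 - η * lam) • sgdIterate ℓ η lam x₀ s t
      - η • gradient (ℓ (s t)) (sgdIterate ℓ η lam x₀ s t)

/-- The number `T₁` of steps after which the norm has converged, as a function of the learning rate
`η`, the weight decay `lam`, the gradient bound `M`, the constant `σmax` and the norm `r = ‖x(0)‖`
of the initialization. -/
def burnIn (η lam M σmax r : ℝ) : ℕ :=
  ⌈1 / (4 * (η * lam)) *
    max (Real.log (M ^ 2 * (η * lam) / σmax ^ 2)
      + |Real.log (2 * Real.exp 4 * M ^ 2 / (r ^ 4 / η ^ 2))| + 8) 8⌉₊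

end SGDWD

end

namespace SGDWD

/-! Scale invariance makes `∇ℓ_g(x)` orthogonal to `x` and homogeneous of degree `-1`. By
Pythagoras, with `a = 1 - ηλ`, the quantity `Z = ‖x(t)‖⁴` satisfies `Z' = a⁴ Z + 2 a² η² q + η⁴ q² /
Z`, where `q` is the squared stochastic gradient norm at the direction of `x(t)`. Up to the last
term this is a linear recursion, solved by a discounted sum of the `q`'s. Azuma-Hoeffding, applied
for each fixed horizon `n < T` and combined by a union bound, replaces `q` by its conditional mean,
which lies between `σmin²` and `σmax²`. Dropping the last term gives the lower bound on `Z` after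
about `1/(ηλ)` steps (`IsNormRecursion.lower`). Once `Z` is that large, the last term is at most `η²
q / 10` and is absorbed, which gives the upper bound (`IsNormRecursion.upper_aux`); the burn-in
makes the trace of the initialization negligible (`burnIn_tail_le`).

For the gradients, the direction performs tangential steps on the sphere with effective rate `w = η
/ (a ‖x‖²)`, so `L` changes by at most `-w ⟪∇L, ∇ℓ⟫ + (ρ/2) w² ‖∇ℓ‖²`
(`IsScaleInvariant.descent_step`). The norm bounds pin `w` to the order of `√(ηλ)`. Summing, the
total decrease of `L` is at most its oscillation, which is at most `ρπ²/2` by following great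
circles (`IsScaleInvariant.sub_le`). The first-order terms have conditional mean `-w ‖∇L‖²`; both
sums concentrate by Azuma-Hoeffding once `w` is truncated to be bounded on every path. -/

/-! ### Azuma-Hoeffding for a recursion driven by independent noise -/

/-- A bound on the lower integral yields integrability and the moment bound at once, so Tonelli can
be used below with no integrability conditions. -/
theorem hasSubgaussianMGF_of_lintegral_le {Ω : Type*} [MeasurableSpace Ω] {P : Measure Ω}
    {Y : Ω → ℝ} {c : NNReal} (hY : Measurable Y)
    (h : ∀ t : ℝ, ∫⁻ ω, ENNReal.ofReal (Real.exp (t * Y ω)) ∂P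
      ≤ ENNReal.ofReal (Real.exp (c * t ^ 2 / 2))) :
    HasSubgaussianMGF Y c P := by
  have hm : ∀ t : ℝ, AEStronglyMeasurable (fun ω => Real.exp (t * Y ω)) P := fun t =>
    (Real.measurable_exp.comp (hY.const_mul t)).aestronglyMeasurable
  refine ⟨fun t => ⟨hm t, ?_⟩, fun t => ?_⟩
  · rw [hasFiniteIntegral_iff_ofReal (Filter.Eventually.of_forall fun _ => (Real.exp_pos _).le)]
    exact (h t).trans_lt ENNReal.ofReal_lt_top
  · rw [mgf, integral_eq_lintegral_of_nonneg_ae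
      (Filter.Eventually.of_forall fun _ => (Real.exp_pos _).le) (hm t)]
    exact ENNReal.toReal_le_of_le_ofReal (Real.exp_pos _).le (h t)

theorem _root_.ProbabilityTheory.HasSubgaussianMGF.lintegral_le {Ω : Type*} [MeasurableSpace Ω]
    {P : Measure Ω} {Y : Ω → ℝ} {c : NNReal} (h : HasSubgaussianMGF Y c P) (t : ℝ) :
    ∫⁻ ω, ENNReal.ofReal (Real.exp (t * Y ω)) ∂P ≤ ENNReal.ofReal (Real.exp (c * t ^ 2 / 2)) := by
  rw [← ofReal_integral_eq_lintegral_ofReal (h.integrable_exp_mul t)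
    (Filter.Eventually.of_forall fun _ => (Real.exp_pos _).le)]
  exact ENNReal.ofReal_le_ofReal (h.mgf_le t)

/-- Adding an increment which is sub-Gaussian for every fixed value of the independent past. -/
theorem hasSubgaussianMGF_add_of_indepFun {Ω α Γ : Type*} [MeasurableSpace Ω] [MeasurableSpace α]
    [MeasurableSpace Γ] {P : Measure Ω} [IsProbabilityMeasure P] {H : Ω → α} {g : Ω → Γ}
    (hH : Measurable H) (hg : Measurable g) (hind : IndepFun H g P) {S : α → ℝ} (hS : Measurable S)
    {ψ : α × Γ → ℝ} (hψ : Measurable ψ) {c c' : NNReal}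
    (h : HasSubgaussianMGF (fun ω => S (H ω)) c P)
    (h' : ∀ a, HasSubgaussianMGF (fun x => ψ (a, x)) c' (P.map g)) :
    HasSubgaussianMGF (fun ω => S (H ω) + ψ (H ω, g ω)) (c + c') P := by
  have hHg : Measurable fun ω => (H ω, g ω) := hH.prodMk hg
  refine hasSubgaussianMGF_of_lintegral_le ((hS.comp hH).add (hψ.comp hHg)) fun t => ?_
  have : IsProbabilityMeasure (P.map g) := Measure.isProbabilityMeasure_map hg.aemeasurable
  have hF : Measurable fun p : α × Γ =>
      ENNReal.ofReal (Real.exp (t * S p.1)) * ENNReal.ofReal (Real.exp (t * ψ p)) := by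
    fun_prop
  calc ∫⁻ ω, ENNReal.ofReal (Real.exp (t * (S (H ω) + ψ (H ω, g ω)))) ∂P
      = ∫⁻ p, ENNReal.ofReal (Real.exp (t * S p.1)) * ENNReal.ofReal (Real.exp (t * ψ p))
          ∂(P.map fun ω => (H ω, g ω)) := by
        rw [lintegral_map hF hHg]
        refine lintegral_congr fun ω => ?_
        rw [mul_add, Real.exp_add, ENNReal.ofReal_mul (Real.exp_pos _).le]
    _ = ∫⁻ a, ∫⁻ x, ENNReal.ofReal (Real.exp (t * S a)) * ENNReal.ofReal (Real.exp (t * ψ (a, x)))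
          ∂(P.map g) ∂(P.map H) := by
        rw [hind.map_prod_eq_prod_map_map hH.aemeasurable hg.aemeasurable,
          lintegral_prod _ hF.aemeasurable]
    _ ≤ ∫⁻ a, ENNReal.ofReal (Real.exp (t * S a)) * ENNReal.ofReal (Real.exp (c' * t ^ 2 / 2))
          ∂(P.map H) := by
        refine lintegral_mono fun a => ?_
        rw [lintegral_const_mul _ (by fun_prop)]
        gcongr
        exact (h' a).lintegral_le t
    _ = (∫⁻ ω, ENNReal.ofReal (Real.exp (t * S (H ω))) ∂P)
          * ENNReal.ofReal (Real.exp (c' * t ^ 2 / 2)) := by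
        rw [lintegral_mul_const _ (by fun_prop), lintegral_map (by fun_prop) hH]
    _ ≤ ENNReal.ofReal (Real.exp (c * t ^ 2 / 2)) * ENNReal.ofReal (Real.exp (c' * t ^ 2 / 2)) := by
        gcongr
        exact h.lintegral_le t
    _ = ENNReal.ofReal (Real.exp (((c + c' : NNReal) : ℝ) * t ^ 2 / 2)) := by
        rw [← ENNReal.ofReal_mul (Real.exp_pos _).le, ← Real.exp_add]
        congr 2
        push_cast
        ring

/-- A sub-Gaussian tail bound, valid also for a vanishing variance proxy. -/
theorem _root_.ProbabilityTheory.HasSubgaussianMGF.measure_sqrt_lt_le {Ω : Type*}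
    [MeasurableSpace Ω] {P : Measure Ω} [IsFiniteMeasure P] {Y : Ω → ℝ} {c : NNReal}
    (h : HasSubgaussianMGF Y c P) {r : ℝ} (hr : 0 ≤ r) :
    P.real {ω | Real.sqrt (2 * c * r) < Y ω} ≤ Real.exp (-r) := by
  -- For `c = 0` the Chernoff exponent would divide by zero. Then `Y = 0` almost surely, and the
  -- event is null because its inequality is strict.
  rcases eq_or_ne c 0 with rfl | hc
  · have h0 : P {ω | Real.sqrt (2 * ((0 : NNReal) : ℝ) * r) < Y ω} = 0 := by
      have := h.ae_eq_zero_of_hasSubgaussianMGF_zero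
      refine measure_mono_null (fun ω hω => ?_) (ae_iff.1 this)
      simp only [NNReal.coe_zero, mul_zero, zero_mul, Real.sqrt_zero, Set.mem_ofPred_eq] at hω
      exact hω.ne'
    rw [measureReal_def, h0]
    exact (Real.exp_pos _).le
  · have hsub : {ω | Real.sqrt (2 * c * r) < Y ω} ⊆ {ω | Real.sqrt (2 * c * r) ≤ Y ω} := by
      intro ω hω
      exact le_of_lt (Set.mem_ofPred_eq ▸ hω)
    refine (measureReal_mono hsub).trans ((h.measure_ge_le (Real.sqrt_nonneg _)).trans_eq ?_)
    rw [Real.sq_sqrt (by positivity)]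
    congr 1
    have : (c : ℝ) ≠ 0 := by simpa using hc
    field_simp

/-- **Azuma-Hoeffding** for sums of bounded functions of the state of a Markov recursion driven by
independent noise and of the next noise variable, centered conditionally on the state. -/
theorem measure_sqrt_lt_sum_le {Ω S Γ : Type*} [MeasurableSpace Ω] [MeasurableSpace S]
    [MeasurableSpace Γ] {P : Measure Ω} [IsProbabilityMeasure P] {ν : Measure Γ}
    [IsProbabilityMeasure ν] {γ : ℕ → Ω → Γ} (hγ_meas : ∀ t, Measurable (γ t))
    (hγ_law : ∀ t, P.map (γ t) = ν) (hγ_indep : iIndepFun γ P)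
    {step : S × Γ → S} (hstep : Measurable step) {X : ℕ → Ω → S} {x₀ : S}
    (hX0 : ∀ ω, X 0 ω = x₀) (hX : ∀ t ω, X (t + 1) ω = step (X t ω, γ t ω))
    {φ : ℕ → S × Γ → ℝ} (hφ : ∀ t, Measurable (φ t)) {lo hi : ℕ → ℝ}
    (hφ_mem : ∀ t p, φ t p ∈ Set.Icc (lo t) (hi t)) (n : ℕ) {r : ℝ} (hr : 0 ≤ r) :
    P.real {ω | Real.sqrt (r / 2 * ∑ t ∈ Finset.range n, (hi t - lo t) ^ 2)
        < ∑ t ∈ Finset.range n, (φ t (X t ω, γ t ω) - ∫ g, φ t (X t ω, g) ∂ν)}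
      ≤ Real.exp (-r) := by
  set D : ℕ → S × Γ → ℝ := fun t p => φ t p - ∫ g, φ t (p.1, g) ∂ν with hD
  have hDm : ∀ t, Measurable (D t) := fun t => by
    refine (hφ t).sub ?_
    have := ((hφ t).stronglyMeasurable.integral_prod_right' (ν := ν)).measurable
    exact this.comp measurable_fst
  -- The noise strictly before time `t`. State and running sum are carried together, so that both
  -- are functions of one past variable independent of `γ t`.
  set past : ℕ → MeasurableSpace Ω := fun t =>
    ⨆ i ∈ Set.Iio t, MeasurableSpace.comap (γ i) inferInstance with hpast
  have hpast_mono : ∀ t, past t ≤ past (t + 1) := fun t =>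
    biSup_mono fun i hi => lt_trans hi (Nat.lt_succ_self t)
  have hγ_past : ∀ t, Measurable[past (t + 1)] (γ t) := fun t => by
    refine Measurable.mono (comap_measurable (γ t)) ?_ le_rfl
    exact le_iSup₂_of_le t (Set.mem_Iio.2 (Nat.lt_succ_self t)) le_rfl
  have hpair : ∀ t, Measurable[past t]
      fun ω => (X t ω, ∑ i ∈ Finset.range t, D i (X i ω, γ i ω)) := by
    intro t
    induction t with
    | zero => simp only [hX0, Finset.range_zero, Finset.sum_empty]; exact measurable_const
    | succ t ih =>
      have h1 := Measurable.mono ih (hpast_mono t) le_rfl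
      have hXt : Measurable[past (t + 1)] (X t) := measurable_fst.comp h1
      have hSt : Measurable[past (t + 1)] fun ω => ∑ i ∈ Finset.range t, D i (X i ω, γ i ω) :=
        measurable_snd.comp h1
      have hXg : Measurable[past (t + 1)] fun ω => (X t ω, γ t ω) := hXt.prodMk (hγ_past t)
      simp only [hX, Finset.sum_range_succ]
      exact (hstep.comp hXg).prodMk (hSt.add ((hDm t).comp hXg))
  have hcomap_le : ∀ i, MeasurableSpace.comap (γ i) inferInstance ≤ ‹MeasurableSpace Ω› :=
    fun i => (hγ_meas i).comap_le
  have hpast_le : ∀ t, past t ≤ ‹MeasurableSpace Ω› := fun t => iSup₂_le fun i _ => hcomap_le i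
  have hind : ∀ t, IndepFun (fun ω => (X t ω, ∑ i ∈ Finset.range t, D i (X i ω, γ i ω)))
      (γ t) P := by
    intro t
    have h1 := indep_iSup_of_disjoint hcomap_le hγ_indep.iIndep
      (S := Set.Iio t) (T := {t}) (by simp)
    rw [IndepFun_iff_Indep]
    refine indep_of_indep_of_le_left (indep_of_indep_of_le_right h1 ?_) (hpair t).comap_le
    simp
  have hsub : ∀ t, HasSubgaussianMGF (fun ω => ∑ i ∈ Finset.range t, D i (X i ω, γ i ω))
      (∑ i ∈ Finset.range t, (‖hi i - lo i‖₊ / 2) ^ 2) P := by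
    intro t
    induction t with
    | zero => simp only [Finset.range_zero, Finset.sum_empty]; exact HasSubgaussianMGF.fun_zero
    | succ t ih =>
      simp only [Finset.sum_range_succ]
      refine hasSubgaussianMGF_add_of_indepFun (α := S × ℝ)
        (H := fun ω => (X t ω, ∑ i ∈ Finset.range t, D i (X i ω, γ i ω))) (S := Prod.snd)
        (ψ := fun q => D t (q.1.1, q.2)) ((hpair t).mono (hpast_le t) le_rfl)
        (hγ_meas t) (hind t) measurable_snd ((hDm t).comp (by fun_prop)) ih fun a => ?_
      rw [hγ_law]
      -- Hoeffding's lemma for a frozen state: `D t` is centered under `ν` by construction.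
      exact hasSubgaussianMGF_of_mem_Icc (((hφ t).comp (by fun_prop)).aemeasurable)
        (Filter.Eventually.of_forall fun g => hφ_mem t (a.1, g))
  have hsum : r / 2 * ∑ t ∈ Finset.range n, (hi t - lo t) ^ 2
      = 2 * ((∑ i ∈ Finset.range n, (‖hi i - lo i‖₊ / 2) ^ 2 : NNReal) : ℝ) * r := by
    push_cast
    rw [Finset.mul_sum, Finset.mul_sum, Finset.sum_mul]
    refine Finset.sum_congr rfl fun i _ => ?_
    rw [Real.norm_eq_abs, div_pow, sq_abs]
    ring
  rw [hsum]
  exact (hsub n).measure_sqrt_lt_le hr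

/-- The two-sided version of `measure_sqrt_lt_sum_le`. -/
theorem measure_sqrt_lt_abs_sum_le {Ω S Γ : Type*} [MeasurableSpace Ω] [MeasurableSpace S]
    [MeasurableSpace Γ] {P : Measure Ω} [IsProbabilityMeasure P] {ν : Measure Γ}
    [IsProbabilityMeasure ν] {γ : ℕ → Ω → Γ} (hγ_meas : ∀ t, Measurable (γ t))
    (hγ_law : ∀ t, P.map (γ t) = ν) (hγ_indep : iIndepFun γ P)
    {step : S × Γ → S} (hstep : Measurable step) {X : ℕ → Ω → S} {x₀ : S}
    (hX0 : ∀ ω, X 0 ω = x₀) (hX : ∀ t ω, X (t + 1) ω = step (X t ω, γ t ω))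
    {φ : ℕ → S × Γ → ℝ} (hφ : ∀ t, Measurable (φ t)) {lo hi : ℕ → ℝ}
    (hφ_mem : ∀ t p, φ t p ∈ Set.Icc (lo t) (hi t)) (n : ℕ) {r : ℝ} (hr : 0 ≤ r) :
    P.real {ω | Real.sqrt (r / 2 * ∑ t ∈ Finset.range n, (hi t - lo t) ^ 2)
        < |∑ t ∈ Finset.range n, (φ t (X t ω, γ t ω) - ∫ g, φ t (X t ω, g) ∂ν)|}
      ≤ 2 * Real.exp (-r) := by
  have h1 := measure_sqrt_lt_sum_le hγ_meas hγ_law hγ_indep hstep hX0 hX hφ hφ_mem n hr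
  have h2 := measure_sqrt_lt_sum_le hγ_meas hγ_law hγ_indep hstep hX0 hX (φ := fun t p => -φ t p)
    (fun t => (hφ t).neg) (lo := fun t => -hi t) (hi := fun t => -lo t)
    (fun t p => ⟨neg_le_neg (hφ_mem t p).2, neg_le_neg (hφ_mem t p).1⟩) n hr
  simp only [neg_sub_neg, integral_neg] at h2
  rw [two_mul]
  refine (measureReal_mono fun ω hω => ?_).trans
    ((measureReal_union_le _ _).trans (add_le_add h1 h2))
  rw [Set.mem_ofPred_eq, lt_abs] at hω
  refine hω.imp id fun h => ?_
  rw [Set.mem_ofPred_eq, ← Finset.sum_neg_distrib] at *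
  simpa only [neg_sub] using h

/-! ### Homogeneity of gradient and Hessian -/

section ScaleInvariant

variable {d : ℕ} {f : EuclideanSpace ℝ (Fin d) → ℝ}

theorem IsScaleInvariant.gradient_smul (hf : IsScaleInvariant f) {c : ℝ} (hc : 0 < c)
    {x : EuclideanSpace ℝ (Fin d)} (hx : x ≠ 0) :
    gradient f (c • x) = c⁻¹ • gradient f x := by
  have h1 : (fun y => f (c • y)) =ᶠ[nhds x] f := by
    filter_upwards [isOpen_ne.mem_nhds hx] with y hy using hf c hc y hy
  have h2 : fderiv ℝ f x = c • fderiv ℝ f (c • x) := by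
    rw [← h1.fderiv_eq, fderiv_comp_smul]
  rw [gradient, gradient, h2, map_smul, smul_smul, inv_mul_cancel₀ hc.ne', one_smul]

/-- Euler's identity: differentiate the constant function `s ↦ f (s • x)` at `s = 1`. -/
theorem IsScaleInvariant.inner_gradient_self (hf : IsScaleInvariant f)
    {x : EuclideanSpace ℝ (Fin d)} (hx : x ≠ 0) (hd : DifferentiableAt ℝ f x) :
    inner ℝ (gradient f x) x = 0 := by
  rw [inner_gradient_left]
  have h1 : HasDerivAt (fun s : ℝ => f (s • x)) (fderiv ℝ f x x) 1 := by
    have h2 : HasDerivAt (fun s : ℝ => s • x) x 1 := by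
      simpa using (hasDerivAt_id (1 : ℝ)).smul_const x
    have h3 : HasFDerivAt f (fderiv ℝ f x) ((1 : ℝ) • x) := by simpa using hd.hasFDerivAt
    exact h3.comp_hasDerivAt 1 h2
  have h4 : (fun s : ℝ => f (s • x)) =ᶠ[nhds 1] fun _ => f x := by
    filter_upwards [isOpen_Ioi.mem_nhds (Set.mem_Ioi.2 (zero_lt_one (α := ℝ)))] with s hs
    exact hf s hs x hx
  exact h1.unique ((hasDerivAt_const 1 (f x)).congr_of_eventuallyEq h4)

theorem IsScaleInvariant.norm_fderiv_gradient_smul (hf : IsScaleInvariant f) {c : ℝ} (hc : 0 < c)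
    {x : EuclideanSpace ℝ (Fin d)} (hx : x ≠ 0) :
    ‖fderiv ℝ (gradient f) (c • x)‖ = (c ^ 2)⁻¹ * ‖fderiv ℝ (gradient f) x‖ := by
  have h1 : (fun y => gradient f (c • y)) =ᶠ[nhds x] fun y => c⁻¹ • gradient f y := by
    filter_upwards [isOpen_ne.mem_nhds hx] with y hy using hf.gradient_smul hc hy
  have h2 : c • fderiv ℝ (gradient f) (c • x) = c⁻¹ • fderiv ℝ (gradient f) x := by
    rw [← fderiv_comp_smul, h1.fderiv_eq]
    exact congrFun (fderiv_const_smul_field (𝕜 := ℝ) (f := gradient f) c⁻¹) x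
  have h3 : fderiv ℝ (gradient f) (c • x) = (c ^ 2)⁻¹ • fderiv ℝ (gradient f) x := by
    have := congrArg (fun A => c⁻¹ • A) h2
    simp only [smul_smul, inv_mul_cancel₀ hc.ne', one_smul] at this
    rw [this, pow_two, mul_inv]
  rw [h3, norm_smul, Real.norm_of_nonneg (by positivity)]

theorem differentiableAt_gradient (hf : ContDiffOn ℝ 2 f {0}ᶜ) {x : EuclideanSpace ℝ (Fin d)}
    (hx : x ≠ 0) : DifferentiableAt ℝ (gradient f) x := by
  have h1 : ContDiffAt ℝ 2 f x := hf.contDiffAt (isOpen_compl_singleton.mem_nhds hx)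
  have h2 : DifferentiableAt ℝ (fderiv ℝ f) x :=
    (h1.fderiv_right (m := 1) (by norm_num)).differentiableAt (by norm_num)
  exact (InnerProductSpace.toDual ℝ
    (EuclideanSpace ℝ (Fin d))).symm.differentiable.differentiableAt.comp x h2

theorem continuousAt_fderiv_gradient (hf : ContDiffOn ℝ 2 f {0}ᶜ)
    {x : EuclideanSpace ℝ (Fin d)} (hx : x ≠ 0) : ContinuousAt (fderiv ℝ (gradient f)) x := by
  have h1 : ContDiffAt ℝ 2 f x := hf.contDiffAt (isOpen_compl_singleton.mem_nhds hx)
  have h2 : ContDiffAt ℝ 1 (fderiv ℝ f) x := h1.fderiv_right (m := 1) (by norm_num)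
  have h3 : ContDiffAt ℝ 1 (gradient f) x :=
    (InnerProductSpace.toDual ℝ (EuclideanSpace ℝ (Fin d))).symm.contDiff.contDiffAt.comp x h2
  exact (h3.fderiv_right (m := 0) (by norm_num)).continuousAt

/-- A real `⨆` bounds its terms only if the family is bounded; here compactness of the sphere and
continuity of the Hessian ensure this. -/
theorem norm_fderiv_gradient_le_hessianBound (hf : ContDiffOn ℝ 2 f {0}ᶜ)
    {x : EuclideanSpace ℝ (Fin d)} (hx : ‖x‖ = 1) :
    ‖fderiv ℝ (gradient f) x‖ ≤ hessianBound f := by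
  have hne : ∀ y : Metric.sphere (0 : EuclideanSpace ℝ (Fin d)) 1,
      (y : EuclideanSpace ℝ (Fin d)) ≠ 0 := fun y => ne_zero_of_mem_unit_sphere y
  have hcont : Continuous fun y : Metric.sphere (0 : EuclideanSpace ℝ (Fin d)) 1 =>
      ‖fderiv ℝ (gradient f) (y : EuclideanSpace ℝ (Fin d))‖ :=
    (continuous_iff_continuousAt.2 fun y => ContinuousAt.comp
      (f := ((↑) : Metric.sphere (0 : EuclideanSpace ℝ (Fin d)) 1 → _))
      (continuousAt_fderiv_gradient hf (hne y)) continuous_subtype_val.continuousAt).norm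
  exact le_ciSup (isCompact_range hcont).bddAbove
    (⟨x, by simpa using hx⟩ : Metric.sphere (0 : EuclideanSpace ℝ (Fin d)) 1)

theorem hessianBound_nonneg : 0 ≤ hessianBound f :=
  Real.iSup_nonneg fun _ => norm_nonneg _

/-- The Hessian is homogeneous of degree `-2`, hence decreases along rays. This extends the bound to
segments tangent to the sphere. -/
theorem IsScaleInvariant.norm_fderiv_gradient_le (hf : IsScaleInvariant f)
    (hf2 : ContDiffOn ℝ 2 f {0}ᶜ) {x : EuclideanSpace ℝ (Fin d)} (hx : 1 ≤ ‖x‖) :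
    ‖fderiv ℝ (gradient f) x‖ ≤ hessianBound f := by
  have hpos : 0 < ‖x‖ := by linarith
  have hx0 : x ≠ 0 := norm_pos_iff.1 hpos
  have h1 : ‖‖x‖⁻¹ • x‖ = 1 := by
    rw [norm_smul, norm_inv, norm_norm, inv_mul_cancel₀ hpos.ne']
  have h2 : x = ‖x‖ • (‖x‖⁻¹ • x) := by rw [smul_smul, mul_inv_cancel₀ hpos.ne', one_smul]
  rw [h2, hf.norm_fderiv_gradient_smul hpos (norm_pos_iff.1 (by rw [h1]; exact one_pos))]
  calc (‖x‖ ^ 2)⁻¹ * ‖fderiv ℝ (gradient f) (‖x‖⁻¹ • x)‖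
      ≤ 1 * ‖fderiv ℝ (gradient f) (‖x‖⁻¹ • x)‖ := by
        gcongr
        exact inv_le_one_of_one_le₀ (one_le_pow₀ hx)
    _ ≤ hessianBound f := by
        rw [one_mul]
        exact norm_fderiv_gradient_le_hessianBound hf2 h1

end ScaleInvariant

/-! ### Second-order estimates on the line and for periodic functions -/

section Taylor

variable {f f' f'' : ℝ → ℝ} {C : ℝ}

theorem abs_deriv_sub_le (hf' : ∀ s, HasDerivAt f' (f'' s) s) (hC : ∀ s, |f'' s| ≤ C) (a b : ℝ) :
    |f' b - f' a| ≤ C * |b - a| :=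
  Convex.norm_image_sub_le_of_norm_hasDerivWithin_le (s := Set.univ)
    (fun s _ => (hf' s).hasDerivWithinAt) (fun s _ => hC s) convex_univ trivial trivial

/-- The parabola minus `f` has a derivative with the sign of `s - a`, so it is minimal at `a`. No
continuity of `f''` is needed. -/
theorem le_taylor_of_abs_deriv_le (hf : ∀ s, HasDerivAt f (f' s) s)
    (hf' : ∀ s, HasDerivAt f' (f'' s) s) (hC : ∀ s, |f'' s| ≤ C) (a b : ℝ) :
    f b ≤ f a + f' a * (b - a) + C / 2 * (b - a) ^ 2 := by
  set g : ℝ → ℝ := fun s => f a + f' a * (s - a) + C / 2 * (s - a) ^ 2 - f s with hg_def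
  have hg : ∀ s, HasDerivAt g (f' a + C * (s - a) - f' s) s := fun s => by
    have h1 : HasDerivAt (fun s => s - a) 1 s := (hasDerivAt_id s).sub_const a
    have h2 := (((h1.const_mul (f' a)).const_add (f a)).add
      ((h1.pow 2).const_mul (C / 2))).sub (hf s)
    convert! h2 using 1
    simp
    ring
  have hga : g a = 0 := by simp [hg_def]
  have hgc : Continuous g := continuous_iff_continuousAt.2 fun s => (hg s).continuousAt
  suffices 0 ≤ g b by
    simp only [hg_def] at this
    linarith
  rcases le_total a b with h | h
  · have hmono : MonotoneOn g (Set.Ici a) := monotoneOn_of_deriv_nonneg (convex_Ici a)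
      hgc.continuousOn (fun s _ => (hg s).differentiableAt.differentiableWithinAt) fun s hs => by
        rw [interior_Ici, Set.mem_Ioi] at hs
        rw [(hg s).deriv]
        have := abs_le.1 (abs_deriv_sub_le hf' hC a s)
        rw [abs_of_pos (sub_pos.2 hs)] at this
        linarith [this.2]
    rw [← hga]
    exact hmono Set.self_mem_Ici h h
  · have hmono : AntitoneOn g (Set.Iic a) := antitoneOn_of_deriv_nonpos (convex_Iic a)
      hgc.continuousOn (fun s _ => (hg s).differentiableAt.differentiableWithinAt) fun s hs => by
        rw [interior_Iic, Set.mem_Iio] at hs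
        rw [(hg s).deriv]
        have := abs_le.1 (abs_deriv_sub_le hf' hC a s)
        rw [abs_of_neg (sub_neg.2 hs)] at this
        linarith [this.1]
    rw [← hga]
    exact hmono h Set.self_mem_Iic h

/-- A `2π`-periodic function with `|f''| ≤ C` has a critical point, which is a global minimum,
within distance `π` of any point. -/
theorem exists_isMin_of_periodic (hf : ∀ s, HasDerivAt f (f' s) s)
    (hper : Function.Periodic f (2 * Real.pi)) (a : ℝ) :
    ∃ m, |a - m| ≤ Real.pi ∧ f' m = 0 ∧ ∀ s, f m ≤ f s := by
  have hc : Continuous f := continuous_iff_continuousAt.2 fun s => (hf s).continuousAt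
  obtain ⟨m, hm, hmin⟩ := (isCompact_Icc (a := a - Real.pi) (b := a + Real.pi)).exists_isMinOn
    ⟨a, by constructor <;> linarith [Real.pi_pos]⟩ hc.continuousOn
  have hglob : ∀ s, f m ≤ f s := fun s => by
    obtain ⟨y, hy, hys⟩ := hper.exists_mem_Ico Real.two_pi_pos s (a - Real.pi)
    rw [hys]
    exact hmin ⟨hy.1, by linarith [hy.2]⟩
  refine ⟨m, abs_le.2 ⟨by linarith [hm.2], by linarith [hm.1]⟩, ?_, hglob⟩
  exact IsLocalMin.hasDerivAt_eq_zero (Filter.Eventually.of_forall hglob) (hf m)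

theorem abs_deriv_le_of_periodic (hf : ∀ s, HasDerivAt f (f' s) s)
    (hf' : ∀ s, HasDerivAt f' (f'' s) s) (hC : ∀ s, |f'' s| ≤ C)
    (hper : Function.Periodic f (2 * Real.pi)) (a : ℝ) : |f' a| ≤ C * Real.pi := by
  obtain ⟨m, hm, hm0, -⟩ := exists_isMin_of_periodic hf hper a
  have h := abs_deriv_sub_le hf' hC m a
  rw [hm0, sub_zero] at h
  exact h.trans (mul_le_mul_of_nonneg_left hm ((abs_nonneg _).trans (hC 0)))

/-- Taylor's bound is taken at a global minimum, where the linear term vanishes and which is at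
distance at most `π` from `a`. -/
theorem sub_le_of_periodic (hf : ∀ s, HasDerivAt f (f' s) s)
    (hf' : ∀ s, HasDerivAt f' (f'' s) s) (hC : ∀ s, |f'' s| ≤ C)
    (hper : Function.Periodic f (2 * Real.pi)) (a b : ℝ) : f a - f b ≤ C / 2 * Real.pi ^ 2 := by
  obtain ⟨m, hm, hm0, hmin⟩ := exists_isMin_of_periodic hf hper a
  have h := le_taylor_of_abs_deriv_le hf hf' hC m a
  rw [hm0, zero_mul, add_zero, ← sq_abs (a - m)] at h
  have h0 : 0 ≤ C := (abs_nonneg _).trans (hC 0)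
  have h1 : C / 2 * |a - m| ^ 2 ≤ C / 2 * Real.pi ^ 2 := by gcongr
  linarith [hmin b]

end Taylor

/-! ### Descent, gradient bound and oscillation on the unit sphere -/

section Sphere

variable {d : ℕ} {f : EuclideanSpace ℝ (Fin d) → ℝ}

theorem norm_direction {x : EuclideanSpace ℝ (Fin d)} (hx : x ≠ 0) :
    ‖direction x‖ = 1 := by
  rw [direction, norm_smul, norm_inv, norm_norm, inv_mul_cancel₀ (norm_ne_zero_iff.2 hx)]

theorem IsScaleInvariant.apply_direction (hf : IsScaleInvariant f)
    {x : EuclideanSpace ℝ (Fin d)} (hx : x ≠ 0) : f (direction x) = f x :=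
  hf _ (inv_pos.2 (norm_pos_iff.2 hx)) x hx

/-- First and second derivative of `f` along a twice differentiable curve avoiding the origin. -/
theorem hasDerivAt_comp_curve (hf : ContDiffOn ℝ 2 f {0}ᶜ)
    {c c' c'' : ℝ → EuclideanSpace ℝ (Fin d)} (hc0 : ∀ s, c s ≠ 0)
    (hc : ∀ s, HasDerivAt c (c' s) s) (hc' : ∀ s, HasDerivAt c' (c'' s) s) :
    (∀ s, HasDerivAt (fun s => f (c s)) (inner ℝ (gradient f (c s)) (c' s)) s) ∧
    ∀ s, HasDerivAt (fun s => inner ℝ (gradient f (c s)) (c' s))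
      (inner ℝ (fderiv ℝ (gradient f) (c s) (c' s)) (c' s)
        + inner ℝ (gradient f (c s)) (c'' s)) s := by
  refine ⟨fun s => ?_, fun s => ?_⟩
  · have h1 : DifferentiableAt ℝ f (c s) :=
      (hf.contDiffAt (isOpen_compl_singleton.mem_nhds (hc0 s))).differentiableAt (by norm_num)
    rw [inner_gradient_left]
    exact h1.hasFDerivAt.comp_hasDerivAt s (hc s)
  · have h1 := (differentiableAt_gradient hf (hc0 s)).hasFDerivAt.comp_hasDerivAt s (hc s)
    rw [add_comm]
    exact h1.inner ℝ (hc' s)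

theorem norm_add_sq_of_inner_eq_zero {x u : EuclideanSpace ℝ (Fin d)} (hxu : inner ℝ x u = 0) :
    ‖x + u‖ ^ 2 = ‖x‖ ^ 2 + ‖u‖ ^ 2 := by
  rw [norm_add_sq_real, hxu]
  ring

theorem abs_inner_fderiv_gradient_le (x u : EuclideanSpace ℝ (Fin d)) :
    |inner ℝ (fderiv ℝ (gradient f) x u) u| ≤ ‖fderiv ℝ (gradient f) x‖ * ‖u‖ ^ 2 := by
  refine (abs_real_inner_le_norm _ _).trans ?_
  rw [pow_two, ← mul_assoc]
  exact mul_le_mul_of_nonneg_right (ContinuousLinearMap.le_opNorm _ _) (norm_nonneg _)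

/-- The descent inequality for a step orthogonal to a point of the unit sphere. -/
theorem IsScaleInvariant.apply_add_le (hf : IsScaleInvariant f) (hf2 : ContDiffOn ℝ 2 f {0}ᶜ)
    {x u : EuclideanSpace ℝ (Fin d)} (hx : ‖x‖ = 1) (hxu : inner ℝ x u = 0) :
    f (x + u) ≤ f x + inner ℝ (gradient f x) u + hessianBound f / 2 * ‖u‖ ^ 2 := by
  -- As `u ⊥ x`, the segment stays outside the open unit ball: it avoids the origin, and the Hessian
  -- there is at most `hessianBound f`.
  have hnorm : ∀ s : ℝ, 1 ≤ ‖x + s • u‖ := fun s => by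
    have h := norm_add_sq_of_inner_eq_zero (x := x) (u := s • u) (by
      rw [inner_smul_right, hxu, mul_zero])
    rw [hx] at h
    nlinarith [norm_nonneg (x + s • u), sq_nonneg ‖s • u‖]
  have hne : ∀ s : ℝ, x + s • u ≠ 0 := fun s => norm_pos_iff.1 (by linarith [hnorm s])
  have hc : ∀ s : ℝ, HasDerivAt (fun s : ℝ => x + s • u) u s := fun s => by
    simpa using ((hasDerivAt_id s).smul_const u).const_add x
  obtain ⟨h1, h2⟩ := hasDerivAt_comp_curve hf2 hne hc fun s => hasDerivAt_const s u
  have h3 := le_taylor_of_abs_deriv_le h1 h2 (C := hessianBound f * ‖u‖ ^ 2) (fun s => by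
    rw [inner_zero_right, add_zero]
    refine (abs_inner_fderiv_gradient_le _ _).trans ?_
    gcongr
    exact hf.norm_fderiv_gradient_le hf2 (hnorm s)) 0 1
  simp only [one_smul, zero_smul, add_zero, sub_zero, mul_one, one_pow] at h3
  linarith

section GreatCircle

variable {x v : EuclideanSpace ℝ (Fin d)}

theorem norm_cos_smul_add_sin_smul (hx : ‖x‖ = 1) (hv : ‖v‖ = 1) (hxv : inner ℝ x v = 0) (s : ℝ) :
    ‖Real.cos s • x + Real.sin s • v‖ = 1 := by
  have h := norm_add_sq_of_inner_eq_zero (x := Real.cos s • x) (u := Real.sin s • v) (by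
    rw [inner_smul_right, inner_smul_left, hxv, mul_zero, mul_zero])
  rw [norm_smul, norm_smul, hx, hv, mul_one, mul_one, Real.norm_eq_abs, Real.norm_eq_abs, sq_abs,
    sq_abs, Real.cos_sq_add_sin_sq] at h
  exact (sq_eq_sq₀ (norm_nonneg _) zero_le_one).1 (by rw [h, one_pow])

/-- The derivative of a scale invariant function along a great circle, and a bound on the second
derivative. -/
theorem IsScaleInvariant.hasDerivAt_greatCircle (hf : IsScaleInvariant f)
    (hf2 : ContDiffOn ℝ 2 f {0}ᶜ) (hx : ‖x‖ = 1) (hv : ‖v‖ = 1) (hxv : inner ℝ x v = 0) :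
    ∃ f' f'' : ℝ → ℝ,
      (∀ s, HasDerivAt (fun s => f (Real.cos s • x + Real.sin s • v)) (f' s) s) ∧
      (∀ s, HasDerivAt f' (f'' s) s) ∧ (∀ s, |f'' s| ≤ hessianBound f) ∧
      f' 0 = inner ℝ (gradient f x) v := by
  have hnorm := norm_cos_smul_add_sin_smul hx hv hxv
  have hne : ∀ s : ℝ, Real.cos s • x + Real.sin s • v ≠ 0 := fun s =>
    norm_pos_iff.1 (by rw [hnorm s]; exact one_pos)
  have hc : ∀ s : ℝ, HasDerivAt (fun s => Real.cos s • x + Real.sin s • v)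
      (Real.cos s • v + Real.sin s • (-x)) s := fun s => by
    convert! ((Real.hasDerivAt_cos s).smul_const x).add ((Real.hasDerivAt_sin s).smul_const v)
      using 1
    rw [smul_neg, neg_smul, add_comm]
  have hc' : ∀ s : ℝ, HasDerivAt (fun s => Real.cos s • v + Real.sin s • (-x))
      (-(Real.cos s • x + Real.sin s • v)) s := fun s => by
    convert! ((Real.hasDerivAt_cos s).smul_const v).add ((Real.hasDerivAt_sin s).smul_const (-x))
      using 1
    rw [smul_neg, neg_smul, neg_add, add_comm]
  obtain ⟨h1, h2⟩ := hasDerivAt_comp_curve hf2 hne hc hc'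
  refine ⟨_, _, h1, h2, fun s => ?_, by simp⟩
  have hd : DifferentiableAt ℝ f (Real.cos s • x + Real.sin s • v) :=
    (hf2.contDiffAt (isOpen_compl_singleton.mem_nhds (hne s))).differentiableAt (by norm_num)
  -- The acceleration of a great circle is radial, hence orthogonal to the gradient; only the
  -- Hessian term, at unit speed, survives.
  rw [inner_neg_right, hf.inner_gradient_self (hne s) hd, neg_zero, add_zero]
  refine (abs_inner_fderiv_gradient_le _ _).trans ?_
  rw [norm_cos_smul_add_sin_smul hv (by rwa [norm_neg])
    (by rw [inner_neg_right, real_inner_comm, hxv, neg_zero]), one_pow, mul_one]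
  exact norm_fderiv_gradient_le_hessianBound hf2 (hnorm s)

theorem periodic_greatCircle (x v : EuclideanSpace ℝ (Fin d)) :
    Function.Periodic (fun s => f (Real.cos s • x + Real.sin s • v)) (2 * Real.pi) := fun s => by
  simp only [Real.cos_add_two_pi, Real.sin_add_two_pi]

end GreatCircle

/-- Along the great circle leaving `x` in the direction of the gradient, the initial derivative is
the gradient norm, and a critical point lies within distance `π`. -/
theorem IsScaleInvariant.norm_gradient_le (hf : IsScaleInvariant f) (hf2 : ContDiffOn ℝ 2 f {0}ᶜ)
    {x : EuclideanSpace ℝ (Fin d)} (hx : ‖x‖ = 1) :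
    ‖gradient f x‖ ≤ hessianBound f * Real.pi := by
  rcases eq_or_ne (gradient f x) 0 with h0 | h0
  · rw [h0, norm_zero]
    exact mul_nonneg hessianBound_nonneg Real.pi_pos.le
  have hx0 : x ≠ 0 := norm_pos_iff.1 (by rw [hx]; exact one_pos)
  have hd : DifferentiableAt ℝ f x :=
    (hf2.contDiffAt (isOpen_compl_singleton.mem_nhds hx0)).differentiableAt (by norm_num)
  obtain ⟨f', f'', h1, h2, h3, h4⟩ := hf.hasDerivAt_greatCircle hf2 hx
    (norm_direction h0) (by
      rw [direction, inner_smul_right, real_inner_comm, hf.inner_gradient_self hx0 hd, mul_zero])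
  have h5 := abs_deriv_le_of_periodic h1 h2 h3 (periodic_greatCircle _ _) 0
  rw [h4, direction, inner_smul_right, real_inner_self_eq_norm_sq, pow_two, ← mul_assoc,
    inv_mul_cancel₀ (norm_ne_zero_iff.2 h0), one_mul, abs_norm] at h5
  exact h5

/-- The orthogonal pair `x₀, w` of nonzero vectors encodes `d ≥ 2`; all orthogonal complements of
lines have the same dimension. -/
theorem exists_norm_eq_one_inner_eq_zero {x₀ w : EuclideanSpace ℝ (Fin d)} (hx₀ : x₀ ≠ 0)
    (hw : w ≠ 0) (hxw : inner ℝ x₀ w = 0) {x : EuclideanSpace ℝ (Fin d)} (hx : x ≠ 0) :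
    ∃ v : EuclideanSpace ℝ (Fin d), ‖v‖ = 1 ∧ inner ℝ x v = 0 := by
  obtain _ | n := d
  · exact absurd (Subsingleton.elim x 0) hx
  have : Fact (Module.finrank ℝ (EuclideanSpace ℝ (Fin (n + 1))) = n + 1) := ⟨by simp⟩
  have h1 := Submodule.finrank_orthogonal_span_singleton (𝕜 := ℝ) (n := n) hx₀
  have h2 := Submodule.finrank_orthogonal_span_singleton (𝕜 := ℝ) (n := n) hx
  have h3 : (Submodule.span ℝ {x₀})ᗮ ≠ ⊥ := fun h =>
    hw ((Submodule.mem_bot ℝ).1 (h ▸ (Submodule.mem_orthogonal_singleton_iff_inner_right.2 hxw)))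
  have h4 : (Submodule.span ℝ {x})ᗮ ≠ ⊥ := fun h => by
    rw [h, finrank_bot] at h2
    exact h3 (Submodule.finrank_eq_zero.1 (h1.trans h2.symm))
  obtain ⟨v, hv, hv0⟩ := Submodule.exists_mem_ne_zero_of_ne_bot h4
  refine ⟨direction v, norm_direction hv0, ?_⟩
  rw [direction, inner_smul_right, Submodule.mem_orthogonal_singleton_iff_inner_right.1 hv,
    mul_zero]

theorem exists_greatCircle {x₀ w : EuclideanSpace ℝ (Fin d)} (hx₀ : x₀ ≠ 0)
    (hw : w ≠ 0) (hxw : inner ℝ x₀ w = 0) {x y : EuclideanSpace ℝ (Fin d)} (hx : ‖x‖ = 1)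
    (hy : ‖y‖ = 1) : ∃ v : EuclideanSpace ℝ (Fin d), ∃ s : ℝ, ‖v‖ = 1 ∧ inner ℝ x v = 0 ∧
      y = Real.cos s • x + Real.sin s • v := by
  have hx0 : x ≠ 0 := norm_pos_iff.1 (by rw [hx]; exact one_pos)
  set c : ℝ := inner ℝ x y with hc
  set z := y - c • x with hz
  have hxz : inner ℝ x z = 0 := by
    rw [hz, inner_sub_right, inner_smul_right, real_inner_self_eq_norm_sq, hx, ← hc]
    ring
  have hyz : y = c • x + z := by rw [hz]; abel
  have hcz : c ^ 2 + ‖z‖ ^ 2 = 1 := by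
    have h := norm_add_sq_of_inner_eq_zero (x := c • x) (u := z) (by
      rw [inner_smul_left, hxz, mul_zero])
    rw [← hyz, hy, norm_smul, hx, mul_one, Real.norm_eq_abs, sq_abs] at h
    linarith
  have hcl : -1 ≤ c ∧ c ≤ 1 := abs_le.1 (abs_le_one_iff_mul_self_le_one.2 (by
    nlinarith [sq_nonneg ‖z‖]))
  have hcos : Real.cos (Real.arccos c) = c := Real.cos_arccos hcl.1 hcl.2
  have hsin : Real.sin (Real.arccos c) = ‖z‖ := by
    rw [Real.sin_arccos, show 1 - c ^ 2 = ‖z‖ ^ 2 by linarith, Real.sqrt_sq (norm_nonneg _)]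
  -- If `y = ±x`, the circle is not determined and any unit tangent vector serves; its existence is
  -- where `d ≥ 2` enters.
  rcases eq_or_ne z 0 with h0 | h0
  · obtain ⟨v, hv, hxv⟩ := exists_norm_eq_one_inner_eq_zero hx₀ hw hxw hx0
    refine ⟨v, Real.arccos c, hv, hxv, ?_⟩
    rw [hcos, hsin, h0, norm_zero, zero_smul, add_zero]
    rw [h0, add_zero] at hyz
    exact hyz
  · refine ⟨direction z, Real.arccos c, norm_direction h0, ?_, ?_⟩
    · rw [direction, inner_smul_right, hxz, mul_zero]
    · rw [hcos, hsin, direction, smul_smul, mul_inv_cancel₀ (norm_ne_zero_iff.2 h0), one_smul]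
      exact hyz

/-- The oscillation of a scale invariant function on the unit sphere in dimension at least `2`. -/
theorem IsScaleInvariant.sub_le (hf : IsScaleInvariant f) (hf2 : ContDiffOn ℝ 2 f {0}ᶜ)
    {x₀ w : EuclideanSpace ℝ (Fin d)} (hx₀ : x₀ ≠ 0) (hw : w ≠ 0) (hxw : inner ℝ x₀ w = 0)
    {x y : EuclideanSpace ℝ (Fin d)} (hx : ‖x‖ = 1) (hy : ‖y‖ = 1) :
    f x - f y ≤ hessianBound f / 2 * Real.pi ^ 2 := by
  obtain ⟨v, s, hv, hxv, hys⟩ := exists_greatCircle hx₀ hw hxw hx hy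
  obtain ⟨f', f'', h1, h2, h3, -⟩ := hf.hasDerivAt_greatCircle hf2 hx hv hxv
  have h4 := sub_le_of_periodic h1 h2 h3 (periodic_greatCircle _ _) 0 s
  simp only [Real.cos_zero, Real.sin_zero, one_smul, zero_smul, add_zero] at h4
  rwa [← hys] at h4

end Sphere

/-! ### Joint measurability of the stochastic gradient -/

section Measurability

variable {d : ℕ} {Γ : Type*} [MeasurableSpace Γ] {ℓ : Γ → EuclideanSpace ℝ (Fin d) → ℝ}

open scoped Classical in
-- Carathéodory's criterion: continuous in the point and measurable in the index. The value at the
-- origin is replaced by `0` because nothing is assumed there.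
theorem measurable_uncurry_of_ne_zero (hℓ_meas : ∀ x, x ≠ 0 → Measurable (fun g => ℓ g x))
    (hℓ_diff : ∀ g x, x ≠ 0 → DifferentiableAt ℝ (ℓ g) x) :
    Measurable fun p : EuclideanSpace ℝ (Fin d) × Γ => if p.1 = 0 then 0 else ℓ p.2 p.1 := by
  have h1 : Measurable (Function.uncurry fun (x : {x : EuclideanSpace ℝ (Fin d) // x ≠ 0})
      (g : Γ) => ℓ g x) :=
    measurable_uncurry_of_continuous_of_measurable
      (fun g => continuous_iff_continuousAt.2 fun x => ContinuousAt.comp (g := ℓ g)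
        (f := (Subtype.val : {x : EuclideanSpace ℝ (Fin d) // x ≠ 0} → _))
        (hℓ_diff g x x.2).continuousAt continuous_subtype_val.continuousAt)
      fun x => hℓ_meas x x.2
  have hs : MeasurableSet {p : EuclideanSpace ℝ (Fin d) × Γ | p.1 = 0} :=
    measurable_fst (measurableSet_singleton 0)
  refine measurable_of_restrict_of_restrict_compl hs ?_ ?_
  · convert! (measurable_const : Measurable fun _ => (0 : ℝ)) using 1
    ext ⟨p, hp⟩
    simp only [Set.domRestrict_apply]
    exact if_pos hp
  · have h2 : Measurable fun p : ↥{p : EuclideanSpace ℝ (Fin d) × Γ | p.1 = 0}ᶜ =>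
        ((⟨p.1.1, p.2⟩ : {x : EuclideanSpace ℝ (Fin d) // x ≠ 0}), p.1.2) :=
      ((measurable_fst.comp measurable_subtype_coe).subtype_mk).prodMk
        (measurable_snd.comp measurable_subtype_coe)
    convert! h1.comp h2 using 1
    ext ⟨p, hp⟩
    simp only [Set.domRestrict_apply]
    exact if_neg hp

open scoped Classical in
/-- The stochastic gradient is jointly measurable away from the origin. -/
theorem measurable_gradient (hℓ_meas : ∀ x, x ≠ 0 → Measurable (fun g => ℓ g x))
    (hℓ_diff : ∀ g x, x ≠ 0 → DifferentiableAt ℝ (ℓ g) x) :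
    Measurable fun p : EuclideanSpace ℝ (Fin d) × Γ =>
      if p.1 = 0 then 0 else gradient (ℓ p.2) p.1 := by
  have hmeas := measurable_uncurry_of_ne_zero hℓ_meas hℓ_diff
  set F := fun p : EuclideanSpace ℝ (Fin d) × Γ => if p.1 = 0 then 0 else ℓ p.2 p.1 with hF
  have hs : MeasurableSet {p : EuclideanSpace ℝ (Fin d) × Γ | p.1 = 0} :=
    measurable_fst (measurableSet_singleton 0)
  have hcoord : ∀ v : EuclideanSpace ℝ (Fin d), Measurable
      fun p : EuclideanSpace ℝ (Fin d) × Γ =>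
        if p.1 = 0 then 0 else fderiv ℝ (ℓ p.2) p.1 v := by
    intro v
    -- Directional derivatives are limits of difference quotients with step `1 / (n + 1)`.
    refine measurable_of_tendsto_metrizable
      (f := fun (n : ℕ) (p : EuclideanSpace ℝ (Fin d) × Γ) =>
        if p.1 = 0 then 0 else ((n : ℝ) + 1) * (F (p.1 + ((n : ℝ) + 1)⁻¹ • v, p.2) - F p))
      (fun n => ?_) (tendsto_pi_nhds.2 fun p => ?_)
    · refine Measurable.ite hs measurable_const (Measurable.const_mul (Measurable.sub ?_ hmeas) _)
      exact hmeas.comp ((measurable_fst.add_const _).prodMk measurable_snd)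
    · rcases eq_or_ne p.1 0 with h0 | h0
      · simp [h0]
      · simp only [h0, if_false]
        have hlim : Filter.Tendsto (fun n : ℕ => ((n : ℝ) + 1)⁻¹ • v) Filter.atTop (nhds 0) := by
          have := (tendsto_one_div_add_atTop_nhds_zero_nat (𝕜 := ℝ)).smul_const v
          simpa using this
        have hc : Filter.Tendsto (fun n : ℕ => ‖(n : ℝ) + 1‖) Filter.atTop Filter.atTop :=
          tendsto_norm_atTop_atTop.comp
            (Filter.tendsto_atTop_add_const_right _ _ tendsto_natCast_atTop_atTop)
        refine ((hℓ_diff p.2 p.1 h0).hasFDerivAt.lim v hc).congr' ?_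
        have hlim2 : Filter.Tendsto (fun n : ℕ => p.1 + ((n : ℝ) + 1)⁻¹ • v) Filter.atTop
            (nhds p.1) := by simpa using hlim.const_add p.1
        filter_upwards [hlim2.eventually (isOpen_ne.mem_nhds h0)] with n hn
        simp only [hF, h0, if_false, smul_eq_mul]
        rw [if_neg hn]
  have heq : (fun p : EuclideanSpace ℝ (Fin d) × Γ =>
      if p.1 = 0 then 0 else gradient (ℓ p.2) p.1) = fun p =>
      ∑ i, (if p.1 = 0 then 0 else fderiv ℝ (ℓ p.2) p.1 (EuclideanSpace.basisFun (Fin d) ℝ i)) •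
        EuclideanSpace.basisFun (Fin d) ℝ i := by
    ext1 p
    rcases eq_or_ne p.1 0 with h0 | h0
    · simp [h0]
    · simp only [h0, if_false]
      rw [← (EuclideanSpace.basisFun (Fin d) ℝ).sum_repr' (gradient (ℓ p.2) p.1)]
      refine Finset.sum_congr rfl fun i _ => ?_
      rw [inner_gradient_right]
      rfl
  rw [heq]
  exact Finset.measurable_sum _ fun i _ => (hcoord _).smul_const _

end Measurability

/-! ### Gradient bounds and the gradient of the expected loss -/

section Bounds

variable {d : ℕ} {Γ : Type*} {ℓ : Γ → EuclideanSpace ℝ (Fin d) → ℝ}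

theorem norm_gradient_le_maxGradNorm (hℓ_bdd : BddAbove (Set.range (sphereGradNorm ℓ))) (g : Γ)
    {x : EuclideanSpace ℝ (Fin d)} (hx : ‖x‖ = 1) : ‖gradient (ℓ g) x‖ ≤ maxGradNorm ℓ :=
  le_ciSup hℓ_bdd (g, (⟨x, by simpa using hx⟩ : Metric.sphere (0 : EuclideanSpace ℝ (Fin d)) 1))

theorem maxGradNorm_nonneg : 0 ≤ maxGradNorm ℓ := Real.iSup_nonneg fun _ => norm_nonneg _

theorem smul_direction {x : EuclideanSpace ℝ (Fin d)} (hx : x ≠ 0) : ‖x‖ • direction x = x := by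
  rw [direction, smul_smul, mul_inv_cancel₀ (norm_ne_zero_iff.2 hx), one_smul]

theorem direction_ne_zero {x : EuclideanSpace ℝ (Fin d)} (hx : x ≠ 0) : direction x ≠ 0 :=
  norm_pos_iff.1 (by rw [norm_direction hx]; exact one_pos)

theorem IsScaleInvariant.gradient_eq_direction {f : EuclideanSpace ℝ (Fin d) → ℝ}
    (hf : IsScaleInvariant f) {x : EuclideanSpace ℝ (Fin d)} (hx : x ≠ 0) :
    gradient f x = ‖x‖⁻¹ • gradient f (direction x) := by
  conv_lhs => rw [← smul_direction hx]
  exact hf.gradient_smul (norm_pos_iff.2 hx) (direction_ne_zero hx)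

theorem norm_gradient_le_div (hℓ_inv : ∀ g, IsScaleInvariant (ℓ g))
    (hℓ_bdd : BddAbove (Set.range (sphereGradNorm ℓ))) (g : Γ) {x : EuclideanSpace ℝ (Fin d)}
    (hx : x ≠ 0) : ‖gradient (ℓ g) x‖ ≤ ‖x‖⁻¹ * maxGradNorm ℓ := by
  rw [(hℓ_inv g).gradient_eq_direction hx, norm_smul, norm_inv, norm_norm]
  gcongr
  exact norm_gradient_le_maxGradNorm hℓ_bdd g (norm_direction hx)

end Bounds

section ExpectedLoss

variable {d : ℕ} {Γ : Type*} [MeasurableSpace Γ] {ν : Measure Γ}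
  {ℓ : Γ → EuclideanSpace ℝ (Fin d) → ℝ}

theorem IsScaleInvariant.expectedLoss (hℓ_inv : ∀ g, IsScaleInvariant (ℓ g)) :
    IsScaleInvariant (expectedLoss ν ℓ) := fun c hc x hx => by
  simp only [SGDWD.expectedLoss, hℓ_inv _ c hc x hx]

theorem measurable_gradient_apply (hℓ_meas : ∀ x, x ≠ 0 → Measurable (fun g => ℓ g x))
    (hℓ_diff : ∀ g x, x ≠ 0 → DifferentiableAt ℝ (ℓ g) x) {x : EuclideanSpace ℝ (Fin d)}
    (hx : x ≠ 0) : Measurable fun g => gradient (ℓ g) x := by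
  classical
  have h := (measurable_gradient hℓ_meas hℓ_diff).comp (measurable_prodMk_left (x := x))
  simpa [Function.comp_def, hx] using h

/-- Differentiation under the integral. On the ball of radius `1/2` around `x` all points have norm
at least `1/2`, so homogeneity dominates every derivative by `2 * maxGradNorm ℓ`. -/
theorem inner_gradient_expectedLoss [IsProbabilityMeasure ν]
    (hℓ_meas : ∀ x, x ≠ 0 → Measurable (fun g => ℓ g x))
    (hℓ_int : ∀ x, x ≠ 0 → Integrable (fun g => ℓ g x) ν)
    (hℓ_diff : ∀ g x, x ≠ 0 → DifferentiableAt ℝ (ℓ g) x)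
    (hℓ_inv : ∀ g, IsScaleInvariant (ℓ g))
    (hℓ_bdd : BddAbove (Set.range (sphereGradNorm ℓ)))
    {x : EuclideanSpace ℝ (Fin d)} (hx : ‖x‖ = 1) (v : EuclideanSpace ℝ (Fin d)) :
    inner ℝ (gradient (expectedLoss ν ℓ) x) v = ∫ g, inner ℝ (gradient (ℓ g) x) v ∂ν := by
  have hx0 : x ≠ 0 := norm_pos_iff.1 (by rw [hx]; exact one_pos)
  have hball : ∀ y ∈ Metric.ball x (1 / 2), 1 / 2 ≤ ‖y‖ := fun y hy => by
    rw [mem_ball_iff_norm] at hy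
    have := norm_sub_norm_le x y
    rw [norm_sub_rev] at hy
    linarith
  have hball0 : ∀ y ∈ Metric.ball x (1 / 2), y ≠ 0 := fun y hy =>
    norm_pos_iff.1 (by linarith [hball y hy])
  have hm : Measurable fun g => fderiv ℝ (ℓ g) x := by
    have := (InnerProductSpace.toDual ℝ (EuclideanSpace ℝ (Fin d))).continuous.measurable.comp
      (measurable_gradient_apply hℓ_meas hℓ_diff hx0)
    simpa [Function.comp_def] using this
  have hbound : ∀ g, ∀ y ∈ Metric.ball x (1 / 2),
      ‖fderiv ℝ (ℓ g) y‖ ≤ 2 * maxGradNorm ℓ := fun g y hy => by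
    rw [← toDual_gradient, LinearIsometryEquiv.norm_map]
    refine (norm_gradient_le_div hℓ_inv hℓ_bdd g (hball0 y hy)).trans ?_
    gcongr
    · exact maxGradNorm_nonneg
    · exact inv_le_of_inv_le₀ (by norm_num) (by linarith [hball y hy])
  have h1 : HasFDerivAt (expectedLoss ν ℓ) (∫ g, fderiv ℝ (ℓ g) x ∂ν) x := by
    refine hasFDerivAt_integral_of_dominated_of_fderiv_le (μ := ν)
      (F := fun x g => ℓ g x) (F' := fun x g => fderiv ℝ (ℓ g) x) (s := Metric.ball x (1 / 2))
      (bound := fun _ => 2 * maxGradNorm ℓ) (Metric.ball_mem_nhds x (by norm_num)) ?_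
      (hℓ_int x hx0) hm.aestronglyMeasurable ?_ (integrable_const _) ?_
    · filter_upwards [isOpen_ne.mem_nhds hx0] with y hy using (hℓ_meas y hy).aestronglyMeasurable
    · exact Filter.Eventually.of_forall fun g y hy => hbound g y hy
    · exact Filter.Eventually.of_forall fun g y hy => (hℓ_diff g y (hball0 y hy)).hasFDerivAt
  have hint : Integrable (fun g => fderiv ℝ (ℓ g) x) ν :=
    Integrable.of_bound hm.aestronglyMeasurable (2 * maxGradNorm ℓ)
      (Filter.Eventually.of_forall fun g => hbound g x (Metric.mem_ball_self (by norm_num)))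
  rw [inner_gradient_left, h1.fderiv, ContinuousLinearMap.integral_apply hint]
  simp only [inner_gradient_left]

end ExpectedLoss

/-! ### Elementary inequalities for the contraction factor -/

section Contraction

variable {x : ℝ}

/-- With `le_four_mul_sq`, this compares the stationary level `1 / (1 - (1 - x)⁴)` of the linear
recursion with `1 / (4x(1 - x)²)`, which cancels the coefficient `2(1 - x)²` of the noise. -/
theorem four_mul_sq_le (hx : 0 < x) (hx1 : x ≤ 0.1) :
    4 * x * (1 - x) ^ 2 ≤ 1 - (1 - x) ^ 4 := by
  norm_num at hx1
  have h : 1 - (1 - x) ^ 4 - 4 * x * (1 - x) ^ 2 = x ^ 2 * (2 - x ^ 2) := by ring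
  have h2 : 0 ≤ x ^ 2 * (2 - x ^ 2) := mul_nonneg (sq_nonneg x) (by nlinarith)
  linarith

theorem le_four_mul_sq (hx : 0 < x) (hx1 : x ≤ 0.1) :
    0.93 * (1 - (1 - x) ^ 4) ≤ 4 * x * (1 - x) ^ 2 := by
  norm_num at hx1
  have h : 4 * x * (1 - x) ^ 2 - 0.93 * (1 - (1 - x) ^ 4)
      = x * (0.28 - 2.42 * x + 0.28 * x ^ 2 + 0.93 * x ^ 3) := by ring
  have h2 : 0 ≤ x * (0.28 - 2.42 * x + 0.28 * x ^ 2 + 0.93 * x ^ 3) :=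
    mul_nonneg hx.le (by norm_num; nlinarith [pow_pos hx 2, pow_pos hx 3])
  linarith

/-- Controls the geometric series of squared weights in the Azuma variance: factor `1 - u²` as `(1 -
u)(1 + u)` and use `1 + u ≥ 2√u` for `u = (1 - x)⁴`. -/
theorem eight_mul_pow_le (hx : 0 < x) (hx1 : x ≤ 0.1) :
    8 * x * (1 - x) ^ 4 ≤ 1 - ((1 - x) ^ 4) ^ 2 := by
  have h1 := four_mul_sq_le hx hx1
  have h2 : 2 * (1 - x) ^ 2 ≤ 1 + (1 - x) ^ 4 := by nlinarith [sq_nonneg ((1 - x) ^ 2 - 1)]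
  have h3 : 0 ≤ 4 * x * (1 - x) ^ 2 := by positivity
  nlinarith [mul_le_mul h1 h2 (by positivity) (h3.trans h1)]

theorem one_sub_pow_le_exp (hx1 : x ≤ 0.1) (n : ℕ) : (1 - x) ^ n ≤ Real.exp (-(x * n)) := by
  norm_num at hx1
  calc (1 - x) ^ n ≤ Real.exp (-x) ^ n := by
        gcongr
        · linarith
        · exact Real.one_sub_le_exp_neg x
    _ = Real.exp (-(x * n)) := by rw [← Real.exp_nat_mul]; congr 1; ring

theorem exp_le_one_sub_pow (hx : 0 < x) (hx1 : x ≤ 0.1) (n : ℕ) :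
    Real.exp (-(10 / 9 * (x * n))) ≤ (1 - x) ^ n := by
  norm_num at hx1
  have h : Real.exp (-(10 / 9 * x)) ≤ 1 - x := by
    rw [Real.exp_neg]
    refine inv_le_of_inv_le₀ (by linarith) (le_trans ?_ (Real.add_one_le_exp _))
    rw [inv_le_iff_one_le_mul₀ (by linarith)]
    nlinarith
  calc Real.exp (-(10 / 9 * (x * n))) = Real.exp (-(10 / 9 * x)) ^ n := by
        rw [← Real.exp_nat_mul]; congr 1; ring
    _ ≤ (1 - x) ^ n := by gcongr

theorem sum_range_pow_sub {u : ℝ} (hu : u ≠ 1) (n : ℕ) :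
    ∑ t ∈ Finset.range n, u ^ (n - 1 - t) = (1 - u ^ n) / (1 - u) := by
  rw [Finset.sum_range_reflect (fun t => u ^ t) n, geom_sum_eq hu, ← neg_div_neg_eq]
  congr 1 <;> ring

theorem sum_range_succ_pow_sub_mul (u : ℝ) (q : ℕ → ℝ) (n : ℕ) :
    ∑ t ∈ Finset.range (n + 1), u ^ (n + 1 - 1 - t) * q t
      = u * ∑ t ∈ Finset.range n, u ^ (n - 1 - t) * q t + q n := by
  rw [Finset.sum_range_succ, Finset.mul_sum]
  congr 1
  · refine Finset.sum_congr rfl fun t ht => ?_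
    have := Finset.mem_range.1 ht
    rw [← mul_assoc, ← pow_succ']
    congr 2
    omega
  · simp

end Contraction

/-! ### The recursion for the fourth power of the norm -/

section NormDynamics

/-- The discounted sum of a sequence, `∑ u ^ (n - 1 - t) * q t`. -/
def discountedSum (u : ℝ) (q : ℕ → ℝ) (n : ℕ) : ℝ := ∑ t ∈ Finset.range n, u ^ (n - 1 - t) * q t

theorem discountedSum_zero (u : ℝ) (q : ℕ → ℝ) : discountedSum u q 0 = 0 := by
  simp [discountedSum]

theorem discountedSum_succ (u : ℝ) (q : ℕ → ℝ) (n : ℕ) :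
    discountedSum u q (n + 1) = u * discountedSum u q n + q n :=
  sum_range_succ_pow_sub_mul u q n

theorem discountedSum_sub (u : ℝ) (q m : ℕ → ℝ) (n : ℕ) :
    discountedSum u (fun t => q t - m t) n = discountedSum u q n - discountedSum u m n := by
  simp only [discountedSum, mul_sub, Finset.sum_sub_distrib]

theorem discountedSum_const {u : ℝ} (hu : u ≠ 1) (s : ℝ) (n : ℕ) :
    discountedSum u (fun _ => s) n = s * ((1 - u ^ n) / (1 - u)) := by
  rw [discountedSum, ← Finset.sum_mul, sum_range_pow_sub hu, mul_comm]

theorem discountedSum_mono {u : ℝ} (hu : 0 ≤ u) {q m : ℕ → ℝ} (h : ∀ t, q t ≤ m t) (n : ℕ) :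
    discountedSum u q n ≤ discountedSum u m n :=
  Finset.sum_le_sum fun t _ => mul_le_mul_of_nonneg_left (h t) (pow_nonneg hu _)

/-- The recursion of the fourth power `Z t = ‖x(t)‖ ^ 4` of the norm of the iterates, where `q t`
is the squared norm of the stochastic gradient at the direction of `x(t)`. -/
structure IsNormRecursion (η lam Q : ℝ) (Z q : ℕ → ℝ) : Prop where
  pos : ∀ n, 0 < Z n
  nonneg : ∀ n, 0 ≤ q n
  le : ∀ n, q n ≤ Q
  succ : ∀ n, Z (n + 1) = (1 - η * lam) ^ 4 * Z n + 2 * (1 - η * lam) ^ 2 * η ^ 2 * q n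
    + η ^ 4 * q n ^ 2 / Z n

variable {η lam Q s S : ℝ} {Z q m : ℕ → ℝ}

namespace IsNormRecursion

theorem discountedSum_le (h : IsNormRecursion η lam Q Z q) (n : ℕ) :
    2 * (1 - η * lam) ^ 2 * η ^ 2 * discountedSum ((1 - η * lam) ^ 4) q n ≤ Z n := by
  induction n with
  | zero => rw [discountedSum_zero, mul_zero]; exact (h.pos 0).le
  | succ n ih =>
    rw [discountedSum_succ, h.succ]
    have h1 : 0 ≤ η ^ 4 * q n ^ 2 / Z n := div_nonneg (by positivity) (h.pos n).le
    have h2 : 0 ≤ (1 - η * lam) ^ 4 := by positivity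
    nlinarith [mul_le_mul_of_nonneg_left ih h2]

theorem pow_mul_le (h : IsNormRecursion η lam Q Z q) (n : ℕ) :
    ((1 - η * lam) ^ 4) ^ n * Z 0 ≤ Z n := by
  induction n with
  | zero => simp
  | succ n ih =>
    rw [h.succ, pow_succ']
    have h1 : 0 ≤ η ^ 4 * q n ^ 2 / Z n := div_nonneg (by positivity) (h.pos n).le
    have h2 : 0 ≤ 2 * (1 - η * lam) ^ 2 * η ^ 2 * q n := mul_nonneg (by positivity) (h.nonneg n)
    have h3 : 0 ≤ (1 - η * lam) ^ 4 := by positivity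
    nlinarith [mul_le_mul_of_nonneg_left ih h3]

/-- The lower bound on the norm after `1 / (η * lam)` steps. -/
theorem lower (h : IsNormRecursion η lam Q Z q) (hη : 0 < η) (hlam : 0 < lam)
    (hx1 : η * lam ≤ 0.1) (hs : 0 < s) (hm : ∀ t, s ≤ m t) {n : ℕ} (hn : 1 ≤ η * lam * n)
    (hdev : |discountedSum ((1 - η * lam) ^ 4) (fun t => q t - m t) n|
      ≤ s / (12 * (1 - η * lam) ^ 2 * (η * lam))) :
    η * s / (4 * lam) ≤ Z n := by
  have hx : 0 < η * lam := mul_pos hη hlam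
  have hlow := h.discountedSum_le n
  set x := η * lam with hxdef
  have hx1' : x ≤ 1 / 10 := by norm_num at hx1; linarith
  have ha : 0 < 1 - x := by linarith
  set u := (1 - x) ^ 4 with hu
  have hu1 : 0.93 * (1 - u) ≤ 4 * x * (1 - x) ^ 2 := le_four_mul_sq hx hx1
  have hu1' : 4 * x * (1 - x) ^ 2 ≤ 1 - u := four_mul_sq_le hx hx1
  have h1u : 0 < 1 - u := lt_of_lt_of_le (by positivity) hu1'
  -- After time `1/x` the weight is at most `exp (-4)`.
  have hun : u ^ n ≤ 0.1 := by
    rw [hu, ← pow_mul, mul_comm, pow_mul]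
    calc ((1 - x) ^ n) ^ 4 ≤ Real.exp (-(x * n)) ^ 4 := by gcongr; exact one_sub_pow_le_exp hx1 n
      _ ≤ Real.exp (-1) ^ 4 := by gcongr
      _ ≤ 0.4 ^ 4 := by gcongr; linarith [Real.exp_neg_one_lt_d9]
      _ ≤ 0.1 := by norm_num
  have hA : s * ((1 - u ^ n) / (1 - u)) - s / (12 * (1 - x) ^ 2 * x) ≤ discountedSum u q n := by
    rw [← discountedSum_const (by linarith), discountedSum_sub] at *
    have := discountedSum_mono (u := u) (by positivity) hm n
    linarith [(abs_le.1 hdev).1]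
  have h2 : 0.93 * 0.9 / (4 * x * (1 - x) ^ 2) ≤ (1 - u ^ n) / (1 - u) := by
    rw [div_le_div_iff₀ (by positivity) h1u]
    have h3 : 0.9 ≤ 1 - u ^ n := by norm_num at hun ⊢; linarith
    have h4 : 0 ≤ 4 * x * (1 - x) ^ 2 := by positivity
    calc 0.93 * 0.9 * (1 - u) = 0.9 * (0.93 * (1 - u)) := by ring
      _ ≤ (1 - u ^ n) * (4 * x * (1 - x) ^ 2) := by
        apply mul_le_mul h3 hu1 _ _
        · norm_num; linarith
        · norm_num at h3; linarith
  calc η * s / (4 * lam)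
      ≤ 2 * (1 - x) ^ 2 * η ^ 2 *
        (s * (0.93 * 0.9 / (4 * x * (1 - x) ^ 2)) - s / (12 * (1 - x) ^ 2 * x)) := by
        -- The numerical coefficient is `0.4185 - 1/6`, just above the required `1/4`.
        have : 2 * (1 - x) ^ 2 * η ^ 2 *
            (s * (0.93 * 0.9 / (4 * x * (1 - x) ^ 2)) - s / (12 * (1 - x) ^ 2 * x))
            = (2 * (0.93 * 0.9 / 4) - 1 / 6) * (η * s / lam) := by
          have : (1 - x) ≠ 0 := ha.ne'
          have e : x = η * lam := hxdef
          generalize 1 - x = a at *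
          rw [e]
          field_simp
          ring
        rw [this, show η * s / (4 * lam) = 1 / 4 * (η * s / lam) by field_simp]
        gcongr
        norm_num
    _ ≤ 2 * (1 - x) ^ 2 * η ^ 2 * discountedSum u q n := by
        gcongr
        refine le_trans ?_ hA
        gcongr
    _ ≤ Z n := hlow

/-- An upper bound on the norm in terms of the initialization and of the discounted sum of the
squared gradient norms, given a lower bound on the norm from time `T₀` on. -/
theorem upper_aux (h : IsNormRecursion η lam Q Z q) (hη : 0 < η) (hlam : 0 < lam)
    (hx1 : η * lam ≤ 0.1) {T₀ n : ℕ} (hZ : ∀ t, T₀ ≤ t → t < n → 10 * η ^ 2 * Q ≤ Z t) :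
    Z n ≤ ((1 - η * lam) ^ 4) ^ n * (Z 0 + 12 * (η ^ 2 * Q / ((1 - η * lam) ^ 4) ^ T₀)
        + (η ^ 2 * Q / ((1 - η * lam) ^ 4) ^ T₀) ^ 2 / Z 0)
      + (2 * (1 - η * lam) ^ 2 + 1 / 10) * η ^ 2 * discountedSum ((1 - η * lam) ^ 4) q n := by
  have hx : 0 < η * lam := mul_pos hη hlam
  have hQ : 0 ≤ Q := (h.nonneg 0).trans (h.le 0)
  have hZ0 := h.pos 0
  have ha : 0 < 1 - η * lam := by norm_num at hx1; linarith
  have ha1 : 1 - η * lam ≤ 1 := by linarith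
  set a := 1 - η * lam with ha_def
  set u := a ^ 4 with hu
  have hu0 : 0 < u := by positivity
  have hu1 : u ≤ 1 := pow_le_one₀ ha.le ha1
  set V := η ^ 2 * Q / u ^ T₀ with hV
  have hV0 : 0 ≤ V := by positivity
  induction n with
  | zero =>
    rw [discountedSum_zero, pow_zero, one_mul, mul_zero, add_zero]
    have : 0 ≤ V ^ 2 / Z 0 := by positivity
    linarith
  | succ n ih =>
    have ih := ih fun t ht htn => hZ t ht (by omega)
    have hqn := h.nonneg n
    have hqQ := h.le n
    have hZn := h.pos n
    rw [h.succ, discountedSum_succ, ← ha_def, ← hu, pow_succ' u n]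
    by_cases hcase : 10 * η ^ 2 * Q ≤ Z n
    -- Large norm: the nonlinear term is absorbed into the coefficient `2a² + 1/10` of the linear
    -- one.
    · have h1 : η ^ 4 * q n ^ 2 / Z n ≤ 1 / 10 * η ^ 2 * q n := by
        rw [div_le_iff₀ hZn]
        have h2 : 10 * η ^ 2 * q n ≤ Z n := le_trans (by gcongr) hcase
        calc η ^ 4 * q n ^ 2 = 1 / 10 * η ^ 2 * q n * (10 * η ^ 2 * q n) := by ring
          _ ≤ _ := by gcongr
      nlinarith [mul_le_mul_of_nonneg_left ih hu0.le]
    -- Small norm, possible only before `T₀`: then `η² Q ≤ u ^ (n + 1) * V`, and the new value is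
    -- bounded afresh without the induction hypothesis. The `12` is `10` from `u * Z n` plus `2`
    -- from the linear term; the nonlinear term costs `V² / Z 0`, by `pow_mul_le`.
    · have hnT : n + 1 ≤ T₀ := by
        by_contra hlt
        exact hcase (hZ n (by omega) (Nat.lt_succ_self n))
      have hpow : u ^ T₀ ≤ u ^ (n + 1) := pow_le_pow_of_le_one hu0.le hu1 hnT
      have hVn : η ^ 2 * Q ≤ u ^ (n + 1) * V := by
        rw [hV, mul_div_assoc', le_div_iff₀ (by positivity), mul_comm]
        gcongr
      have hS : 0 ≤ discountedSum u q n :=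
        Finset.sum_nonneg fun t _ => mul_nonneg (by positivity) (h.nonneg t)
      have h1 : η ^ 4 * q n ^ 2 / Z n ≤ u ^ (n + 1) * (V ^ 2 / Z 0) := by
        have h2 : η ^ 4 * q n ^ 2 / Z n ≤ η ^ 4 * Q ^ 2 / (u ^ n * Z 0) := by
          gcongr
          exact h.pow_mul_le n
        refine h2.trans ?_
        rw [div_le_iff₀ (by positivity)]
        have h3 : u ^ (n + 1) * (V ^ 2 / Z 0) * (u ^ n * Z 0) = (u ^ (n + 1) * V) * (u ^ n * V) := by
          field_simp
        rw [h3]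
        have h4 : η ^ 2 * Q ≤ u ^ n * V := hVn.trans (by
          gcongr ?_ * V
          exact pow_le_pow_of_le_one hu0.le hu1 (Nat.le_succ n))
        calc η ^ 4 * Q ^ 2 = (η ^ 2 * Q) * (η ^ 2 * Q) := by ring
          _ ≤ _ := by gcongr
      have h5 : u * Z n ≤ 10 * (u ^ (n + 1) * V) := by
        have : u * Z n ≤ 1 * Z n := by gcongr
        linarith
      have h6 : 2 * a ^ 2 * η ^ 2 * q n ≤ 2 * (u ^ (n + 1) * V) := by
        have : a ^ 2 ≤ 1 := pow_le_one₀ ha.le ha1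
        have : a ^ 2 * (η ^ 2 * q n) ≤ 1 * (η ^ 2 * Q) := by gcongr
        linarith
      have h7 : 0 ≤ (2 * a ^ 2 + 1 / 10) * η ^ 2 * (u * discountedSum u q n + q n) := by positivity
      have h8 : 0 ≤ u ^ (n + 1) * Z 0 := by positivity
      rw [← pow_succ' u n]
      linarith

/-- The mean contributes `1/4` and the deviation `1/12` to the discounted sum; with `2a² + 1/10 ≤
2.2a²` this makes `2.2/3 < 0.75`, leaving `0.25` for the initialization. -/
theorem upper_discountedSum (hη : 0 < η) (hlam : 0 < lam)
    (hx1 : η * lam ≤ 0.1) (hsS : s ≤ S) (hs : 0 ≤ s) (hm : ∀ t, m t ≤ S) {n : ℕ}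
    (hdev : |discountedSum ((1 - η * lam) ^ 4) (fun t => q t - m t) n|
      ≤ s / (12 * (1 - η * lam) ^ 2 * (η * lam))) :
    (2 * (1 - η * lam) ^ 2 + 1 / 10) * η ^ 2 * discountedSum ((1 - η * lam) ^ 4) q n
      ≤ 0.75 * (η * S / lam) := by
  have hx : 0 < η * lam := mul_pos hη hlam
  set x := η * lam with hxdef
  have hx1' : x ≤ 1 / 10 := by norm_num at hx1; linarith
  have ha : 0 < 1 - x := by linarith
  set u := (1 - x) ^ 4 with hu
  have hu1' : 4 * x * (1 - x) ^ 2 ≤ 1 - u := four_mul_sq_le hx hx1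
  have h1u : 0 < 1 - u := lt_of_lt_of_le (by positivity) hu1'
  have hS : 0 ≤ S := hs.trans hsS
  have hA : discountedSum u q n ≤ S * (1 / (4 * x * (1 - x) ^ 2)) + S / (12 * (1 - x) ^ 2 * x) := by
    have h1 := discountedSum_mono (u := u) (by positivity) hm n
    rw [discountedSum_const (by linarith)] at h1
    rw [discountedSum_sub] at hdev
    have h2 : S * ((1 - u ^ n) / (1 - u)) ≤ S * (1 / (4 * x * (1 - x) ^ 2)) := by
      gcongr
      linarith [pow_nonneg (show 0 ≤ u by positivity) n]
    have h3 : s / (12 * (1 - x) ^ 2 * x) ≤ S / (12 * (1 - x) ^ 2 * x) := by gcongr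
    linarith [(abs_le.1 hdev).2]
  have hcoef : 2 * (1 - x) ^ 2 + 1 / 10 ≤ 2.2 * (1 - x) ^ 2 := by norm_num; nlinarith
  calc (2 * (1 - x) ^ 2 + 1 / 10) * η ^ 2 * discountedSum u q n
      ≤ (2 * (1 - x) ^ 2 + 1 / 10) * η ^ 2 *
        (S * (1 / (4 * x * (1 - x) ^ 2)) + S / (12 * (1 - x) ^ 2 * x)) := by gcongr
    _ ≤ 2.2 * (1 - x) ^ 2 * η ^ 2 *
        (S * (1 / (4 * x * (1 - x) ^ 2)) + S / (12 * (1 - x) ^ 2 * x)) := by gcongr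
    _ = 2.2 / 3 * (η * S / lam) := by
        have : (1 - x) ≠ 0 := ha.ne'
        have e : x = η * lam := hxdef
        generalize 1 - x = a at *
        rw [e]
        field_simp
        ring
    _ ≤ 0.75 * (η * S / lam) := by
        gcongr
        norm_num

end IsNormRecursion

end NormDynamics

/-! ### Forgetting the initialization -/

section BurnIn

variable {η lam M σ r : ℝ}

theorem exp_neg_abs_log_le {K : ℝ} (hK : 0 < K) :
    Real.exp (-|Real.log K|) ≤ K ∧ Real.exp (-|Real.log K|) ≤ K⁻¹ := by
  constructor
  · calc Real.exp (-|Real.log K|) ≤ Real.exp (Real.log K) :=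
        Real.exp_le_exp.2 (neg_abs_le _)
      _ = K := Real.exp_log hK
  · calc Real.exp (-|Real.log K|) ≤ Real.exp (-Real.log K) :=
        Real.exp_le_exp.2 (neg_le_neg (le_abs_self _))
      _ = K⁻¹ := by rw [Real.exp_neg, Real.exp_log hK]

theorem burnIn_spec (hx : 0 < η * lam) :
    max (Real.log (M ^ 2 * (η * lam) / σ ^ 2)
      + |Real.log (2 * Real.exp 4 * M ^ 2 / (r ^ 4 / η ^ 2))| + 8) 8
      ≤ 4 * (η * lam * burnIn η lam M σ r) := by
  have h := Nat.le_ceil (1 / (4 * (η * lam)) *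
    max (Real.log (M ^ 2 * (η * lam) / σ ^ 2)
      + |Real.log (2 * Real.exp 4 * M ^ 2 / (r ^ 4 / η ^ 2))| + 8) 8)
  rw [one_div_mul_eq_div, div_le_iff₀ (by positivity)] at h
  refine h.trans_eq ?_
  rw [burnIn, one_div_mul_eq_div]
  ring

theorem two_le_mul_burnIn (hx : 0 < η * lam) : 2 ≤ η * lam * burnIn η lam M σ r := by
  have := (le_max_right _ _).trans (burnIn_spec (M := M) (σ := σ) (r := r) hx)
  linarith

theorem exp_burnIn_le (hη : 0 < η) (hlam : 0 < lam) (hM : 0 < M) (hσ : 0 < σ) :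
    Real.exp (-(4 * (η * lam * burnIn η lam M σ r)))
      ≤ Real.exp (-8) * (σ ^ 2 / (M ^ 2 * (η * lam)))
        * Real.exp (-|Real.log (2 * Real.exp 4 * M ^ 2 / (r ^ 4 / η ^ 2))|) := by
  have hx : 0 < η * lam := mul_pos hη hlam
  have h1 := (le_max_left _ _).trans (burnIn_spec (M := M) (σ := σ) (r := r) hx)
  have h2 : σ ^ 2 / (M ^ 2 * (η * lam)) = Real.exp (-Real.log (M ^ 2 * (η * lam) / σ ^ 2)) := by
    rw [Real.exp_neg, Real.exp_log (by positivity), inv_div]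
  rw [h2, ← Real.exp_add, ← Real.exp_add]
  exact Real.exp_le_exp.2 (by linarith)

/-- After the burn-in, the contribution of the initialization to the fourth power of the norm is
small. -/
theorem burnIn_tail_le (hη : 0 < η) (hlam : 0 < lam) (hx1 : η * lam ≤ 0.1) (hM : 0 < M)
    (hσ : 0 < σ) (hr : 0 < r) (hMσ : 72 * (η * lam) * M ^ 2 ≤ σ ^ 2) {T₀ n : ℕ}
    (hT₀ : η * lam * T₀ ≤ 1.1) (hn : burnIn η lam M σ r ≤ n) :
    ((1 - η * lam) ^ 4) ^ n * (r ^ 4 + 12 * (η ^ 2 * M ^ 2 / ((1 - η * lam) ^ 4) ^ T₀)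
        + (η ^ 2 * M ^ 2 / ((1 - η * lam) ^ 4) ^ T₀) ^ 2 / r ^ 4)
      ≤ 0.25 * (η * σ ^ 2 / lam) := by
  have hx : 0 < η * lam := mul_pos hη hlam
  have hx1' : η * lam ≤ 1 / 10 := by norm_num at hx1; linarith
  have ha : 0 < 1 - η * lam := by linarith
  set E := Real.exp (-(4 * (η * lam * burnIn η lam M σ r))) with hE
  set K := 2 * Real.exp 4 * M ^ 2 / (r ^ 4 / η ^ 2) with hK
  have hK0 : 0 < K := by positivity
  obtain ⟨hK1, hK2⟩ := exp_neg_abs_log_le hK0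
  have hE8 : E ≤ Real.exp (-8) :=
    Real.exp_le_exp.2 (by linarith [two_le_mul_burnIn (M := M) (σ := σ) (r := r) hx])
  have hEb := exp_burnIn_le (r := r) hη hlam hM hσ
  rw [← hE, ← hK] at hEb
  -- The absolute value in `burnIn` lets `E` be bounded with `K` or with `K⁻¹`: the former cancels
  -- `r⁴`, the latter `1 / r⁴`.
  have hEK : E ≤ Real.exp (-8) * (σ ^ 2 / (M ^ 2 * (η * lam))) * K := hEb.trans (by gcongr)
  have hEK' : E ≤ Real.exp (-8) * (σ ^ 2 / (M ^ 2 * (η * lam))) * K⁻¹ := hEb.trans (by gcongr)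
  have hun : ((1 - η * lam) ^ 4) ^ n ≤ E := by
    rw [← pow_mul, mul_comm 4 n, pow_mul]
    calc ((1 - η * lam) ^ n) ^ 4 ≤ Real.exp (-(η * lam * n)) ^ 4 := by
          gcongr; exact one_sub_pow_le_exp hx1 n
      _ = Real.exp (-(4 * (η * lam * n))) := by rw [← Real.exp_nat_mul]; congr 1; push_cast; ring
      _ ≤ E := by
          refine Real.exp_le_exp.2 (neg_le_neg ?_)
          gcongr
  -- The exponent is `4 · (10/9) · 1.1 < 5`.
  have hV : η ^ 2 * M ^ 2 / ((1 - η * lam) ^ 4) ^ T₀ ≤ η ^ 2 * M ^ 2 * Real.exp 5 := by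
    rw [div_le_iff₀ (by positivity), mul_assoc]
    refine le_mul_of_one_le_right (by positivity) ?_
    calc (1 : ℝ) = Real.exp 5 * Real.exp (-5) := by rw [← Real.exp_add]; norm_num
      _ ≤ Real.exp 5 * Real.exp (-(10 / 9 * (η * lam * T₀))) ^ 4 := by
        rw [← Real.exp_nat_mul]
        gcongr
        norm_num at hT₀ ⊢
        linarith
      _ ≤ Real.exp 5 * ((1 - η * lam) ^ T₀) ^ 4 := by
        gcongr
        exact exp_le_one_sub_pow hx hx1 T₀
      _ = Real.exp 5 * ((1 - η * lam) ^ 4) ^ T₀ := by rw [← pow_mul, ← pow_mul, mul_comm T₀]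
  set V := η ^ 2 * M ^ 2 / ((1 - η * lam) ^ 4) ^ T₀
  have hV0 : 0 ≤ V := by positivity
  have he4 : Real.exp (-8) * Real.exp 4 = Real.exp (-1) ^ 4 := by
    rw [← Real.exp_add, ← Real.exp_nat_mul]; norm_num
  have he3 : Real.exp (-8) * Real.exp 5 = Real.exp (-1) ^ 3 := by
    rw [← Real.exp_add, ← Real.exp_nat_mul]; norm_num
  have he2 : Real.exp (-8) * (Real.exp 5 ^ 2 * (Real.exp 4)⁻¹) = Real.exp (-1) ^ 2 := by
    rw [← Real.exp_neg, ← Real.exp_nat_mul, ← Real.exp_add, ← Real.exp_add, ← Real.exp_nat_mul]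
    norm_num
  have he : Real.exp (-1) ≤ 0.4 := by norm_num; linarith [Real.exp_neg_one_lt_d9]
  set Y := η * σ ^ 2 / lam with hY
  have hY0 : 0 < Y := by positivity
  have t1 : E * r ^ 4 ≤ 2 * Real.exp (-1) ^ 4 * Y := by
    calc E * r ^ 4 ≤ Real.exp (-8) * (σ ^ 2 / (M ^ 2 * (η * lam))) * K * r ^ 4 := by gcongr
      _ = 2 * (Real.exp (-8) * Real.exp 4) * Y := by
        rw [hK, hY]
        field_simp
      _ = _ := by rw [he4]
  have t2 : E * (12 * V) ≤ Real.exp (-1) ^ 3 / 6 * Y := by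
    have h1 : 72 * (η ^ 2 * M ^ 2) ≤ Y := by
      rw [hY, le_div_iff₀ hlam]
      nlinarith [mul_le_mul_of_nonneg_left hMσ hη.le]
    calc E * (12 * V) ≤ Real.exp (-8) * (12 * (η ^ 2 * M ^ 2 * Real.exp 5)) := by gcongr
      _ = (Real.exp (-8) * Real.exp 5) / 6 * (72 * (η ^ 2 * M ^ 2)) := by ring
      _ ≤ (Real.exp (-8) * Real.exp 5) / 6 * Y := by gcongr
      _ = _ := by rw [he3]
  have t3 : E * (V ^ 2 / r ^ 4) ≤ Real.exp (-1) ^ 2 / 2 * Y := by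
    calc E * (V ^ 2 / r ^ 4) ≤ Real.exp (-8) * (σ ^ 2 / (M ^ 2 * (η * lam))) * K⁻¹
          * ((η ^ 2 * M ^ 2 * Real.exp 5) ^ 2 / r ^ 4) := by gcongr
      _ = (Real.exp (-8) * (Real.exp 5 ^ 2 * (Real.exp 4)⁻¹)) / 2 * Y := by
        rw [hK, hY]
        field_simp
      _ = _ := by rw [he2]
  calc ((1 - η * lam) ^ 4) ^ n * (r ^ 4 + 12 * V + V ^ 2 / r ^ 4)
      ≤ E * (r ^ 4 + 12 * V + V ^ 2 / r ^ 4) := by gcongr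
    _ ≤ (2 * Real.exp (-1) ^ 4 + Real.exp (-1) ^ 3 / 6 + Real.exp (-1) ^ 2 / 2) * Y := by
        rw [mul_add, mul_add]; linarith
    _ ≤ (2 * 0.4 ^ 4 + 0.4 ^ 3 / 6 + 0.4 ^ 2 / 2) * Y := by gcongr
    _ ≤ 0.25 * Y := by gcongr; norm_num

end BurnIn

/-! ### Consequences of the noise assumption -/

section Condition

/-- The two consequences of the assumption on the noise level `s / Q` which the proof uses. -/
theorem noise_condition {x s Q r : ℝ} (hx : 0 < x) (hQ : 0 < Q) (hr : 8 ≤ r) (hsQ : s ≤ Q)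
    (h : 3 * Real.exp (4 * x) * Real.sqrt (x * r) ≤ s / Q) :
    0 < s ∧ 9 * x * r * Q ^ 2 ≤ s ^ 2 ∧ 72 * x * Q ≤ s := by
  have hxr : 0 < x * r := by positivity
  have h1 : 3 * Real.sqrt (x * r) ≤ s / Q := by
    refine le_trans ?_ h
    gcongr
    linarith [Real.one_le_exp (show 0 ≤ 4 * x by positivity)]
  have h2 : 0 < Real.sqrt (x * r) := Real.sqrt_pos.2 hxr
  rw [le_div_iff₀ hQ] at h1
  have hs : 0 < s := lt_of_lt_of_le (by positivity) h1
  have h3 : 9 * x * r * Q ^ 2 ≤ s ^ 2 := by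
    calc 9 * x * r * Q ^ 2 = (3 * Real.sqrt (x * r) * Q) ^ 2 := by
          rw [mul_pow, mul_pow, Real.sq_sqrt hxr.le]; ring
      _ ≤ s ^ 2 := by gcongr
  refine ⟨hs, h3, ?_⟩
  have h4 : 72 * x * Q ^ 2 ≤ s * Q := by
    calc 72 * x * Q ^ 2 = 9 * x * 8 * Q ^ 2 := by ring
      _ ≤ 9 * x * r * Q ^ 2 := by gcongr
      _ ≤ s ^ 2 := h3
      _ = s * s := pow_two s
      _ ≤ s * Q := by gcongr
  refine le_of_mul_le_mul_right ?_ hQ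
  linarith

/-- The increments have ranges `uⁿ⁻¹⁻ᵗ Q`, whose squares sum to at most `Q² / (8xu)`; the constant
`9` in the hypothesis turns the Azuma radius into the fraction `1/12` needed for the norm bounds. -/
theorem sqrt_deviation_le {x s Q r : ℝ} (hx : 0 < x) (hx1 : x ≤ 0.1) (hs : 0 < s)
    (hr : 0 ≤ r) (h : 9 * x * r * Q ^ 2 ≤ s ^ 2) (n : ℕ) :
    Real.sqrt (r / 2 * ∑ t ∈ Finset.range n, (((1 - x) ^ 4) ^ (n - 1 - t) * Q - 0) ^ 2)
      ≤ s / (12 * (1 - x) ^ 2 * x) := by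
  have hx1' : x ≤ 1 / 10 := by norm_num at hx1; linarith
  have ha : 0 < 1 - x := by linarith
  have h8 := eight_mul_pow_le hx hx1
  set u := (1 - x) ^ 4 with hu
  have h1u : 0 < 1 - u ^ 2 := lt_of_lt_of_le (by positivity) h8
  refine Real.sqrt_le_iff.2 ⟨by positivity, ?_⟩
  have hsum : ∑ t ∈ Finset.range n, (u ^ (n - 1 - t) * Q - 0) ^ 2
      = (1 - (u ^ 2) ^ n) / (1 - u ^ 2) * Q ^ 2 := by
    rw [← sum_range_pow_sub (by linarith), Finset.sum_mul]
    refine Finset.sum_congr rfl fun t _ => ?_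
    rw [sub_zero, mul_pow, pow_right_comm]
  rw [hsum]
  have h2 : (1 - (u ^ 2) ^ n) / (1 - u ^ 2) ≤ 1 / (8 * x * u) := by
    gcongr
    linarith [pow_nonneg (sq_nonneg u) n]
  calc r / 2 * ((1 - (u ^ 2) ^ n) / (1 - u ^ 2) * Q ^ 2)
      ≤ r / 2 * (1 / (8 * x * u) * Q ^ 2) := by gcongr
    _ = (9 * x * r * Q ^ 2) / (144 * x ^ 2 * u) := by
        have : u ≠ 0 := by positivity
        field_simp
        ring
    _ ≤ s ^ 2 / (144 * x ^ 2 * u) := by gcongr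
    _ = (s / (12 * (1 - x) ^ 2 * x)) ^ 2 := by
        rw [hu, div_pow]
        congr 1
        ring

end Condition

/-! ### One step of SGD: norm and loss -/

section Step

variable {d : ℕ} {f L : EuclideanSpace ℝ (Fin d) → ℝ} {η lam : ℝ} {x : EuclideanSpace ℝ (Fin d)}

theorem IsScaleInvariant.norm_sq_step (hf : IsScaleInvariant f) (hx : x ≠ 0)
    (hd : DifferentiableAt ℝ f x) :
    ‖(1 - η * lam) • x - η • gradient f x‖ ^ 2
      = (1 - η * lam) ^ 2 * ‖x‖ ^ 2 + η ^ 2 * ‖gradient f x‖ ^ 2 := by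
  rw [norm_sub_sq_real, inner_smul_left, inner_smul_right, real_inner_comm,
    hf.inner_gradient_self hx hd, norm_smul, norm_smul, mul_pow, mul_pow, Real.norm_eq_abs,
    Real.norm_eq_abs, sq_abs, sq_abs]
  ring

theorem IsScaleInvariant.step_ne_zero (hf : IsScaleInvariant f) (hx : x ≠ 0)
    (hd : DifferentiableAt ℝ f x) (ha : 0 < 1 - η * lam) :
    (1 - η * lam) • x - η • gradient f x ≠ 0 := by
  have h := hf.norm_sq_step (η := η) (lam := lam) hx hd
  have hx' := norm_pos_iff.2 hx
  have h1 : 0 < ‖(1 - η * lam) • x - η • gradient f x‖ ^ 2 := by rw [h]; positivity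
  exact norm_ne_zero_iff.1 fun h0 => by rw [h0] at h1; norm_num at h1

/-- The squared gradient at `x` carries a factor `1 / ‖x‖²`. Squaring the recursion for `‖x‖²`
cancels it in the cross term, so the fourth power obeys an almost linear recursion. -/
theorem IsScaleInvariant.norm_pow_four_step (hf : IsScaleInvariant f) (hx : x ≠ 0)
    (hd : DifferentiableAt ℝ f x) :
    ‖(1 - η * lam) • x - η • gradient f x‖ ^ 4
      = (1 - η * lam) ^ 4 * ‖x‖ ^ 4
        + 2 * (1 - η * lam) ^ 2 * η ^ 2 * ‖gradient f (direction x)‖ ^ 2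
        + η ^ 4 * (‖gradient f (direction x)‖ ^ 2) ^ 2 / ‖x‖ ^ 4 := by
  have h := hf.norm_sq_step (η := η) (lam := lam) hx hd
  have hx' := norm_ne_zero_iff.2 hx
  rw [show ‖(1 - η * lam) • x - η • gradient f x‖ ^ 4
    = (‖(1 - η * lam) • x - η • gradient f x‖ ^ 2) ^ 2 by ring, h, hf.gradient_eq_direction hx,
    norm_smul, norm_inv, norm_norm]
  field_simp
  ring

/-- The new iterate is a positive multiple of the direction of `x` plus a tangent vector, and `L`
ignores the multiple. -/
theorem IsScaleInvariant.descent_step (hf : IsScaleInvariant f) (hx : x ≠ 0)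
    (hd : ∀ y, y ≠ 0 → DifferentiableAt ℝ f y) (hL : IsScaleInvariant L)
    (hL2 : ContDiffOn ℝ 2 L {0}ᶜ) (ha : 0 < 1 - η * lam) :
    L (direction ((1 - η * lam) • x - η • gradient f x)) ≤ L (direction x)
      + (-(η / ((1 - η * lam) * ‖x‖ ^ 2)
          * inner ℝ (gradient L (direction x)) (gradient f (direction x)))
        + hessianBound L / 2 * (η / ((1 - η * lam) * ‖x‖ ^ 2)) ^ 2
          * ‖gradient f (direction x)‖ ^ 2) := by
  have hx' := norm_pos_iff.2 hx
  set e := direction x with he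
  have he0 : e ≠ 0 := direction_ne_zero hx
  set w := η / ((1 - η * lam) * ‖x‖ ^ 2) with hw
  have hstep : (1 - η * lam) • x - η • gradient f x
      = ((1 - η * lam) * ‖x‖) • (e + (-w) • gradient f e) := by
    rw [hf.gradient_eq_direction hx, ← he, smul_add, smul_smul, smul_smul,
      mul_smul (1 - η * lam) ‖x‖ e, he, smul_direction hx, sub_eq_add_neg, ← neg_smul]
    congr 2
    rw [hw]
    field_simp
  have hu : inner ℝ e ((-w) • gradient f e) = 0 := by
    rw [inner_smul_right, real_inner_comm, hf.inner_gradient_self he0 (hd e he0), mul_zero]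
  have h1 := hL.apply_add_le hL2 (norm_direction hx) hu
  rw [hL.apply_direction (hf.step_ne_zero hx (hd x hx) ha), hstep,
    hL _ (mul_pos ha hx') _ (fun h0 => by
      refine hf.step_ne_zero (η := η) (lam := lam) hx (hd x hx) ha ?_
      rw [hstep, h0, smul_zero])]
  refine h1.trans_eq ?_
  rw [inner_smul_right, norm_smul, mul_pow, Real.norm_eq_abs, sq_abs]
  ring

end Step

section Iterates

variable {d : ℕ} {Γ : Type*} {ℓ : Γ → EuclideanSpace ℝ (Fin d) → ℝ} {η lam : ℝ}
  {x₀ : EuclideanSpace ℝ (Fin d)}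

theorem sgdIterate_ne_zero (hℓ_diff : ∀ g x, x ≠ 0 → DifferentiableAt ℝ (ℓ g) x)
    (hℓ_inv : ∀ g, IsScaleInvariant (ℓ g)) (ha : 0 < 1 - η * lam) (hx₀ : x₀ ≠ 0) (s : ℕ → Γ)
    (t : ℕ) : sgdIterate ℓ η lam x₀ s t ≠ 0 := by
  induction t with
  | zero => exact hx₀
  | succ t ih => exact (hℓ_inv (s t)).step_ne_zero ih (hℓ_diff _ _ ih) ha

theorem isNormRecursion_sgdIterate (hℓ_diff : ∀ g x, x ≠ 0 → DifferentiableAt ℝ (ℓ g) x)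
    (hℓ_inv : ∀ g, IsScaleInvariant (ℓ g)) (hℓ_bdd : BddAbove (Set.range (sphereGradNorm ℓ)))
    (ha : 0 < 1 - η * lam) (hx₀ : x₀ ≠ 0) (s : ℕ → Γ) :
    IsNormRecursion η lam (maxGradNorm ℓ ^ 2) (fun t => ‖sgdIterate ℓ η lam x₀ s t‖ ^ 4)
      (fun t => ‖gradient (ℓ (s t)) (direction (sgdIterate ℓ η lam x₀ s t))‖ ^ 2) where
  pos t := pow_pos (norm_pos_iff.2 (sgdIterate_ne_zero hℓ_diff hℓ_inv ha hx₀ s t)) 4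
  nonneg t := sq_nonneg _
  le t := pow_le_pow_left₀ (norm_nonneg _) (norm_gradient_le_maxGradNorm hℓ_bdd _
    (norm_direction (sgdIterate_ne_zero hℓ_diff hℓ_inv ha hx₀ s t))) 2
  succ t := by
    have h0 := sgdIterate_ne_zero hℓ_diff hℓ_inv ha hx₀ s t
    exact (hℓ_inv (s t)).norm_pow_four_step h0 (hℓ_diff _ _ h0)

end Iterates

/-! ### Constants of the average bound, and the two-sided norm bound -/

section Average

/-- Solves the summed descent inequality for `D`, the sum of squared gradient norms. Here `w` is
`√(ηλ)` and `h` bounds the effective rate; `a ≥ 0.9` only serves to get `√2 / a ≤ 2` and `1 / a ≤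
2`. -/
theorem average_le {a w σmin σmax ρ M r N D h : ℝ} (ha : 0.9 ≤ a) (ha1 : a ≤ 1) (hw : 0 < w)
    (hσmin : 0 < σmin) (hσmax : 0 < σmax) (hρ : 0 ≤ ρ) (hr : 0 ≤ r) (hN : 0 < N)
    (hM : 0 ≤ M) (hh : h = 2 * w / (a * σmin))
    (hD : w / (a * (Real.sqrt 2 * σmax)) * D ≤ ρ / 2 * Real.pi ^ 2
      + (Real.sqrt (r / 2 * (N * (2 * (h * (ρ * Real.pi * M))) ^ 2))
        + Real.sqrt (r / 2 * (N * (ρ / 2 * h ^ 2 * M ^ 2) ^ 2)))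
      + N * (ρ / 2 * h ^ 2 * σmax ^ 2)) :
    1 / N * D ≤ Real.pi ^ 2 * ρ * σmax / (N * (Real.sqrt 2 * w))
      + 4 * w * (ρ * σmax ^ 3 / σmin ^ 2)
      + Real.sqrt (r / N) * (4 * (Real.pi * ρ * M * σmax / σmin))
      + Real.sqrt (r / N) * (4 * w * (M ^ 2 * ρ * σmax / σmin ^ 2)) := by
  have ha0 : 0 < a := by norm_num at ha; linarith
  have hpi := Real.pi_pos
  set k := Real.sqrt 2 with hk
  have hk0 : 0 < k := Real.sqrt_pos.2 two_pos
  have hk2 : k ^ 2 = 2 := Real.sq_sqrt two_pos.le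
  have hk1 : k ≤ 1.5 := by norm_num; nlinarith
  set y := Real.sqrt (r / N) with hy
  have hy0 : 0 ≤ y := Real.sqrt_nonneg _
  have hy2 : y ^ 2 = r / N := Real.sq_sqrt (by positivity)
  have hh0 : 0 < h := by rw [hh]; positivity
  have hryN : r = y ^ 2 * N := by rw [hy2]; field_simp
  have hs : ∀ c : ℝ, 0 ≤ c → Real.sqrt (r / 2 * (N * c ^ 2)) = y * N * c / k := fun c hc => by
    rw [Real.sqrt_eq_iff_mul_self_eq (by positivity) (by positivity), hryN, div_mul_div_comm,
      ← pow_two k, hk2]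
    ring
  rw [hs _ (by positivity), hs _ (by positivity)] at hD
  have hD' : 1 / N * D ≤ 1 / N * (a * (k * σmax) / w * (ρ / 2 * Real.pi ^ 2
      + (y * N * (2 * (h * (ρ * Real.pi * M))) / k + y * N * (ρ / 2 * h ^ 2 * M ^ 2) / k)
      + N * (ρ / 2 * h ^ 2 * σmax ^ 2))) := by
    gcongr
    calc D = a * (k * σmax) / w * (w / (a * (k * σmax)) * D) := by field_simp
      _ ≤ _ := by gcongr
  refine hD'.trans ?_
  have t1 : 1 / N * (a * (k * σmax) / w * (ρ / 2 * Real.pi ^ 2))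
      ≤ Real.pi ^ 2 * ρ * σmax / (N * (k * w)) := by
    have : 1 / N * (a * (k * σmax) / w * (ρ / 2 * Real.pi ^ 2))
        = a * (Real.pi ^ 2 * ρ * σmax / (N * (k * w))) := by
      field_simp
      rw [hk2]
      ring
    rw [this]
    exact mul_le_of_le_one_left (by positivity) ha1
  have hka : k / a ≤ 2 := by rw [div_le_iff₀ ha0]; norm_num at ha hk1; linarith
  have hia : 1 / a ≤ 2 := by rw [div_le_iff₀ ha0]; norm_num at ha; linarith
  have t2 : 1 / N * (a * (k * σmax) / w * (N * (ρ / 2 * h ^ 2 * σmax ^ 2)))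
      ≤ 4 * w * (ρ * σmax ^ 3 / σmin ^ 2) := by
    have : 1 / N * (a * (k * σmax) / w * (N * (ρ / 2 * h ^ 2 * σmax ^ 2)))
        = k / a * (2 * w * (ρ * σmax ^ 3 / σmin ^ 2)) := by
      rw [hh]
      field_simp
    rw [this]
    calc _ ≤ 2 * (2 * w * (ρ * σmax ^ 3 / σmin ^ 2)) := by gcongr
      _ = _ := by ring
  have t3 : 1 / N * (a * (k * σmax) / w * (y * N * (2 * (h * (ρ * Real.pi * M))) / k))
      = y * (4 * (Real.pi * ρ * M * σmax / σmin)) := by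
    rw [hh]
    field_simp
    ring
  have t4 : 1 / N * (a * (k * σmax) / w * (y * N * (ρ / 2 * h ^ 2 * M ^ 2) / k))
      ≤ y * (4 * w * (M ^ 2 * ρ * σmax / σmin ^ 2)) := by
    have : 1 / N * (a * (k * σmax) / w * (y * N * (ρ / 2 * h ^ 2 * M ^ 2) / k))
        = 1 / a * (y * (2 * w * (M ^ 2 * ρ * σmax / σmin ^ 2))) := by
      rw [hh]
      field_simp
    rw [this]
    calc _ ≤ 2 * (y * (2 * w * (M ^ 2 * ρ * σmax / σmin ^ 2))) := by gcongr
      _ = _ := by ring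
  simp only [mul_add]
  linarith

end Average

theorem IsNormRecursion.bounds {η lam M σmin σmax r : ℝ} {Z q m : ℕ → ℝ}
    (h : IsNormRecursion η lam (M ^ 2) Z q) (hη : 0 < η) (hlam : 0 < lam)
    (hx1 : η * lam ≤ 0.1) (hM : 0 < M) (hσmin : 0 < σmin) (hσ : σmin ≤ σmax)
    (hMσ : 72 * (η * lam) * M ^ 2 ≤ σmin ^ 2) (hm : ∀ t, σmin ^ 2 ≤ m t)
    (hm' : ∀ t, m t ≤ σmax ^ 2) (hr : 0 < r) (hZ0 : Z 0 = r ^ 4) {T : ℕ}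
    (hdev : ∀ n < T, |discountedSum ((1 - η * lam) ^ 4) (fun t => q t - m t) n|
      ≤ σmin ^ 2 / (12 * (1 - η * lam) ^ 2 * (η * lam))) {n : ℕ} (hnT : n < T)
    (hn : burnIn η lam M σmax r ≤ n) :
    η * σmin ^ 2 / (4 * lam) ≤ Z n ∧ Z n ≤ η * σmax ^ 2 / lam := by
  have hx : 0 < η * lam := mul_pos hη hlam
  have hx1' : η * lam ≤ 1 / 10 := by norm_num at hx1; linarith
  have hσmax : 0 < σmax := hσmin.trans_le hσ
  have hσ2 : σmin ^ 2 ≤ σmax ^ 2 := by gcongr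
  have hlow : ∀ t, ⌈1 / (η * lam)⌉₊ ≤ t → t < T → η * σmin ^ 2 / (4 * lam) ≤ Z t :=
    fun t ht htT => h.lower hη hlam hx1 (by positivity) hm (by
      have := Nat.ceil_le.1 ht
      rw [div_le_iff₀ hx] at this
      linarith) (hdev t htT)
  have hT₀n : ⌈1 / (η * lam)⌉₊ ≤ n := by
    refine Nat.ceil_le.2 ?_
    rw [div_le_iff₀ hx]
    have h1 := two_le_mul_burnIn (M := M) (σ := σmax) (r := r) hx
    have h2 : η * lam * burnIn η lam M σmax r ≤ η * lam * n := by gcongr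
    linarith
  have hT₀ : η * lam * ⌈1 / (η * lam)⌉₊ ≤ 1.1 := by
    have h1 := (Nat.ceil_lt_add_one (show 0 ≤ 1 / (η * lam) by positivity)).le
    calc η * lam * ⌈1 / (η * lam)⌉₊ ≤ η * lam * (1 / (η * lam) + 1) := by gcongr
      _ = 1 + η * lam := by field_simp
      _ ≤ 1.1 := by norm_num; linarith
  refine ⟨hlow n hT₀n hnT, ?_⟩
  -- The lower bound on `Z` is at least `18 η² M²` because `72 ηλ M² ≤ σmin²`, so it triggers the
  -- large-norm regime.
  have hup := h.upper_aux hη hlam hx1 (T₀ := ⌈1 / (η * lam)⌉₊) (n := n) fun t ht htn => by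
    refine le_trans ?_ (hlow t ht (htn.trans hnT))
    rw [le_div_iff₀ (by positivity)]
    nlinarith [mul_le_mul_of_nonneg_left hMσ hη.le, show 0 ≤ η * (η * lam * M ^ 2) by positivity]
  rw [hZ0] at hup
  have h1 := burnIn_tail_le hη hlam hx1 hM hσmax hr (hMσ.trans hσ2) hT₀ hn
  have h2 := IsNormRecursion.upper_discountedSum hη hlam hx1 hσ2 (by positivity) hm' (hdev n hnT)
  norm_num at h1 h2
  norm_num at hup
  linarith

/-! ### Truncated effective rates and the two noise terms -/

section StepWeight

variable {d : ℕ} {η lam a σmin σmax : ℝ} {x : EuclideanSpace ℝ (Fin d)}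

/-- The effective learning rate `η / (a ‖x‖ ^ 2)`, set to zero where `‖x‖ ^ 4 < B`. -/
noncomputable def stepWeight (η a B : ℝ) (x : EuclideanSpace ℝ (Fin d)) : ℝ :=
  if B ≤ ‖x‖ ^ 4 then η / (a * ‖x‖ ^ 2) else 0

theorem measurable_stepWeight (η a B : ℝ) :
    Measurable (stepWeight η a B : EuclideanSpace ℝ (Fin d) → ℝ) := by
  refine Measurable.ite (measurableSet_le measurable_const (by fun_prop)) ?_ measurable_const
  fun_prop

theorem stepWeight_of_le {B : ℝ} (h : B ≤ ‖x‖ ^ 4) :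
    stepWeight η a B x = η / (a * ‖x‖ ^ 2) := if_pos h

theorem stepWeight_nonneg (hη : 0 < η) (ha : 0 < a) (B : ℝ) : 0 ≤ stepWeight η a B x := by
  rw [stepWeight]
  split_ifs <;> positivity

/-- Thanks to the truncation this holds at every point, also on paths where the norm bounds fail, as
Azuma-Hoeffding requires. -/
theorem stepWeight_le (hη : 0 < η) (hlam : 0 < lam) (ha : 0 < a) (hσmin : 0 < σmin) :
    stepWeight η a (η * σmin ^ 2 / (4 * lam)) x ≤ 2 * Real.sqrt (η * lam) / (a * σmin) := by
  have hw : 0 < Real.sqrt (η * lam) := Real.sqrt_pos.2 (mul_pos hη hlam)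
  have hw2 : Real.sqrt (η * lam) ^ 2 = η * lam := Real.sq_sqrt (mul_pos hη hlam).le
  rw [stepWeight]
  split_ifs with h
  · rw [div_le_iff₀ (by positivity)] at h
    have h1 : η * σmin ≤ 2 * Real.sqrt (η * lam) * ‖x‖ ^ 2 := by
      refine le_of_sq_le_sq ?_ (by positivity)
      rw [mul_pow, mul_pow, mul_pow, hw2]
      nlinarith [mul_le_mul_of_nonneg_left h hη.le]
    have hx0 : 0 < ‖x‖ ^ 2 := by
      by_contra hcon
      have : ‖x‖ ^ 2 = 0 := le_antisymm (not_lt.1 hcon) (sq_nonneg _)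
      rw [this, mul_zero] at h1
      exact absurd h1 (not_le.2 (by positivity))
    rw [div_le_div_iff₀ (by positivity) (by positivity)]
    nlinarith [mul_le_mul_of_nonneg_left h1 ha.le]
  · positivity

theorem le_effective_rate (hη : 0 < η) (hlam : 0 < lam) (ha : 0 < a) (hσmax : 0 < σmax)
    (hx : x ≠ 0) (h : ‖x‖ ^ 4 ≤ η * σmax ^ 2 / lam) :
    Real.sqrt (η * lam) / (a * (Real.sqrt 2 * σmax)) ≤ η / (a * ‖x‖ ^ 2) := by
  have hw2 : Real.sqrt (η * lam) ^ 2 = η * lam := Real.sq_sqrt (mul_pos hη hlam).le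
  have hx' := norm_pos_iff.2 hx
  have hk2 : Real.sqrt 2 ^ 2 = 2 := Real.sq_sqrt two_pos.le
  have hk0 : 0 < Real.sqrt 2 := Real.sqrt_pos.2 two_pos
  rw [le_div_iff₀ hlam] at h
  have h1 : Real.sqrt (η * lam) * ‖x‖ ^ 2 ≤ η * (Real.sqrt 2 * σmax) := by
    refine le_of_sq_le_sq ?_ (by positivity)
    rw [mul_pow, mul_pow, mul_pow, hw2, hk2]
    nlinarith [mul_le_mul_of_nonneg_left h hη.le, show 0 ≤ η * (η * σmax ^ 2) by positivity]
  rw [div_le_div_iff₀ (by positivity) (by positivity)]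
  nlinarith [mul_le_mul_of_nonneg_left h1 ha.le]

end StepWeight

section Increments

variable {d : ℕ} {Γ : Type*} {ℓ : Γ → EuclideanSpace ℝ (Fin d) → ℝ}

open scoped Classical in
/-- The stochastic gradient at the direction of a vector, set to zero at the origin. -/
noncomputable def sphereGrad (ℓ : Γ → EuclideanSpace ℝ (Fin d) → ℝ)
    (p : EuclideanSpace ℝ (Fin d) × Γ) : EuclideanSpace ℝ (Fin d) :=
  if p.1 = 0 then 0 else gradient (ℓ p.2) (direction p.1)

theorem sphereGrad_of_ne_zero {x : EuclideanSpace ℝ (Fin d)} (hx : x ≠ 0) (g : Γ) :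
    sphereGrad ℓ (x, g) = gradient (ℓ g) (direction x) := if_neg hx

theorem norm_sphereGrad_le (hℓ_bdd : BddAbove (Set.range (sphereGradNorm ℓ)))
    (p : EuclideanSpace ℝ (Fin d) × Γ) : ‖sphereGrad ℓ p‖ ≤ maxGradNorm ℓ := by
  rw [sphereGrad]
  split_ifs with h
  · rw [norm_zero]; exact maxGradNorm_nonneg
  · exact norm_gradient_le_maxGradNorm hℓ_bdd _ (norm_direction h)

theorem measurable_direction :
    Measurable (direction : EuclideanSpace ℝ (Fin d) → EuclideanSpace ℝ (Fin d)) := by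
  unfold direction
  fun_prop

theorem measurable_sphereGrad [MeasurableSpace Γ]
    (hℓ_meas : ∀ x, x ≠ 0 → Measurable (fun g => ℓ g x))
    (hℓ_diff : ∀ g x, x ≠ 0 → DifferentiableAt ℝ (ℓ g) x) : Measurable (sphereGrad ℓ) := by
  classical
  have h := (measurable_gradient hℓ_meas hℓ_diff).comp
    ((measurable_direction.comp measurable_fst).prodMk measurable_snd)
  convert! h using 1
  ext1 p
  rcases eq_or_ne p.1 0 with h0 | h0
  · simp [sphereGrad, direction, h0]
  · simp [sphereGrad, direction_ne_zero h0, h0]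

theorem measurable_gradient_direction (f : EuclideanSpace ℝ (Fin d) → ℝ) :
    Measurable fun x => gradient f (direction x) :=
  ((InnerProductSpace.toDual ℝ (EuclideanSpace ℝ (Fin d))).symm.continuous.measurable.comp
    (measurable_fderiv ℝ f)).comp measurable_direction

/-- The first-order term of the descent inequality from time `t₁` on. -/
noncomputable def linTerm (L : EuclideanSpace ℝ (Fin d) → ℝ)
    (ℓ : Γ → EuclideanSpace ℝ (Fin d) → ℝ) (η a B : ℝ) (t₁ t : ℕ)
    (p : EuclideanSpace ℝ (Fin d) × Γ) : ℝ :=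
  if t₁ ≤ t then -(stepWeight η a B p.1 *
    inner ℝ (gradient L (direction p.1)) (sphereGrad ℓ p)) else 0

/-- The second-order term of the descent inequality from time `t₁` on. -/
noncomputable def quadTerm (ρ : ℝ) (ℓ : Γ → EuclideanSpace ℝ (Fin d) → ℝ) (η a B : ℝ) (t₁ t : ℕ)
    (p : EuclideanSpace ℝ (Fin d) × Γ) : ℝ :=
  if t₁ ≤ t then ρ / 2 * stepWeight η a B p.1 ^ 2 * ‖sphereGrad ℓ p‖ ^ 2 else 0

variable {L : EuclideanSpace ℝ (Fin d) → ℝ} {η a B ρ h : ℝ} {t₁ t : ℕ}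

theorem measurable_linTerm [MeasurableSpace Γ] (hG : Measurable (sphereGrad ℓ)) :
    Measurable (linTerm L ℓ η a B t₁ t) := by
  unfold linTerm
  split_ifs
  · exact (((measurable_stepWeight η a B).comp measurable_fst).mul
      (((measurable_gradient_direction L).comp measurable_fst).inner hG)).neg
  · exact measurable_const

theorem measurable_quadTerm [MeasurableSpace Γ] (hG : Measurable (sphereGrad ℓ)) :
    Measurable (quadTerm ρ ℓ η a B t₁ t) := by
  unfold quadTerm
  split_ifs
  · exact ((((measurable_stepWeight η a B).comp measurable_fst).pow_const 2).const_mul _).mul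
      (hG.norm.pow_const 2)
  · exact measurable_const

theorem linTerm_mem_Icc (hη : 0 < η) (ha : 0 < a)
    (hℓ_bdd : BddAbove (Set.range (sphereGradNorm ℓ))) (hL : IsScaleInvariant L)
    (hL2 : ContDiffOn ℝ 2 L {0}ᶜ) (hh : ∀ x : EuclideanSpace ℝ (Fin d), stepWeight η a B x ≤ h)
    (p : EuclideanSpace ℝ (Fin d) × Γ) :
    linTerm L ℓ η a B t₁ t p ∈ Set.Icc
      (if t₁ ≤ t then -(h * (hessianBound L * Real.pi * maxGradNorm ℓ)) else 0)
      (if t₁ ≤ t then h * (hessianBound L * Real.pi * maxGradNorm ℓ) else 0) := by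
  rw [linTerm]
  split_ifs
  · rw [Set.mem_Icc, ← abs_le, abs_neg, abs_mul, abs_of_nonneg (stepWeight_nonneg hη ha B)]
    have hpi := Real.pi_pos
    have hρ : 0 ≤ hessianBound L := hessianBound_nonneg
    have hM : 0 ≤ maxGradNorm ℓ := maxGradNorm_nonneg
    have h0 : 0 ≤ h := (stepWeight_nonneg hη ha B).trans (hh 0)
    gcongr
    · exact hh _
    · rcases eq_or_ne p.1 0 with h0 | h0
      · rw [sphereGrad, if_pos h0, inner_zero_right, abs_zero]
        positivity
      · refine (abs_real_inner_le_norm _ _).trans ?_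
        gcongr
        · exact hL.norm_gradient_le hL2 (norm_direction h0)
        · exact norm_sphereGrad_le hℓ_bdd p
  · simp

theorem quadTerm_mem_Icc (hη : 0 < η) (ha : 0 < a) (hρ : 0 ≤ ρ)
    (hℓ_bdd : BddAbove (Set.range (sphereGradNorm ℓ)))
    (hh : ∀ x : EuclideanSpace ℝ (Fin d), stepWeight η a B x ≤ h)
    (p : EuclideanSpace ℝ (Fin d) × Γ) :
    quadTerm ρ ℓ η a B t₁ t p ∈ Set.Icc 0
      (if t₁ ≤ t then ρ / 2 * h ^ 2 * maxGradNorm ℓ ^ 2 else 0) := by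
  rw [quadTerm]
  split_ifs
  · refine ⟨by positivity, ?_⟩
    gcongr
    · exact stepWeight_nonneg hη ha B
    · exact hh _
    · exact norm_sphereGrad_le hℓ_bdd p
  · simp

variable [MeasurableSpace Γ] {ν : Measure Γ}

/-- The stochastic gradient averages to `∇L`, so its inner product with `∇L` averages to `‖∇L‖²`. -/
theorem integral_linTerm [IsProbabilityMeasure ν]
    (hℓ_meas : ∀ x, x ≠ 0 → Measurable (fun g => ℓ g x))
    (hℓ_int : ∀ x, x ≠ 0 → Integrable (fun g => ℓ g x) ν)
    (hℓ_diff : ∀ g x, x ≠ 0 → DifferentiableAt ℝ (ℓ g) x)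
    (hℓ_inv : ∀ g, IsScaleInvariant (ℓ g))
    (hℓ_bdd : BddAbove (Set.range (sphereGradNorm ℓ)))
    {x : EuclideanSpace ℝ (Fin d)} (hx : x ≠ 0) :
    ∫ g, linTerm (expectedLoss ν ℓ) ℓ η a B t₁ t (x, g) ∂ν = if t₁ ≤ t then
      -(stepWeight η a B x * ‖gradient (expectedLoss ν ℓ) (direction x)‖ ^ 2) else 0 := by
  simp only [linTerm]
  split_ifs
  · simp only [sphereGrad_of_ne_zero hx]
    rw [integral_neg, integral_const_mul]
    simp only [real_inner_comm]
    rw [← inner_gradient_expectedLoss hℓ_meas hℓ_int hℓ_diff hℓ_inv hℓ_bdd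
      (norm_direction hx), real_inner_self_eq_norm_sq]
  · simp

theorem integral_quadTerm_le (hη : 0 < η) (ha : 0 < a) (hρ : 0 ≤ ρ) {σmax : ℝ}
    (hσmax : ∀ x : EuclideanSpace ℝ (Fin d), ‖x‖ = 1 →
      ∫ g, ‖gradient (ℓ g) x‖ ^ 2 ∂ν ≤ σmax ^ 2)
    (hh : ∀ x : EuclideanSpace ℝ (Fin d), stepWeight η a B x ≤ h)
    {x : EuclideanSpace ℝ (Fin d)} (hx : x ≠ 0) :
    ∫ g, quadTerm ρ ℓ η a B t₁ t (x, g) ∂ν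
      ≤ if t₁ ≤ t then ρ / 2 * h ^ 2 * σmax ^ 2 else 0 := by
  simp only [quadTerm]
  split_ifs
  · simp only [sphereGrad_of_ne_zero hx]
    rw [integral_const_mul]
    gcongr
    · exact stepWeight_nonneg hη ha B
    · exact hh _
    · exact hσmax _ (norm_direction hx)
  · simp

end Increments

theorem sum_range_ite_le (F : ℕ → ℝ) {t₁ T : ℕ} (hT : t₁ < T) :
    ∑ t ∈ Finset.range T, (if t₁ ≤ t then F t else 0) = ∑ t ∈ Finset.Icc t₁ (T - 1), F t := by
  rw [← Finset.sum_filter]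
  refine Finset.sum_congr ?_ fun _ _ => rfl
  ext t
  simp only [Finset.mem_filter, Finset.mem_range, Finset.mem_Icc]
  omega

theorem sum_range_ite_le_const (c : ℝ) {t₁ T : ℕ} (hT : t₁ < T) :
    ∑ t ∈ Finset.range T, (if t₁ ≤ t then c else 0) = ((T : ℝ) - t₁) * c := by
  rw [sum_range_ite_le _ hT, Finset.sum_const, Nat.card_Icc, nsmul_eq_mul,
    Nat.sub_add_cancel (by omega), Nat.cast_sub hT.le]

/-! ### Deterministic estimate along a good path -/

section Path

variable {d : ℕ} {Γ : Type*} [MeasurableSpace Γ] {ν : Measure Γ} [IsProbabilityMeasure ν]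
  {ℓ : Γ → EuclideanSpace ℝ (Fin d) → ℝ}

/-- The bound on the average squared gradient norm along a path on which the norm has converged and
the two noise terms are controlled. -/
theorem path_average_le (hℓ_meas : ∀ x, x ≠ 0 → Measurable (fun g => ℓ g x))
    (hℓ_int : ∀ x, x ≠ 0 → Integrable (fun g => ℓ g x) ν)
    (hℓ_diff : ∀ g x, x ≠ 0 → DifferentiableAt ℝ (ℓ g) x)
    (hℓ_inv : ∀ g, IsScaleInvariant (ℓ g))
    (hℓ_bdd : BddAbove (Set.range (sphereGradNorm ℓ)))
    (hL : ContDiffOn ℝ 2 (expectedLoss ν ℓ) {0}ᶜ)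
    {σmin σmax : ℝ} (hσmin_pos : 0 < σmin) (hσmax_pos : 0 < σmax)
    (hσmax : ∀ x : EuclideanSpace ℝ (Fin d), ‖x‖ = 1 →
      ∫ g, ‖gradient (ℓ g) x‖ ^ 2 ∂ν ≤ σmax ^ 2)
    {x₁ v : EuclideanSpace ℝ (Fin d)} (hx₁ : x₁ ≠ 0) (hv : v ≠ 0) (hx₁v : inner ℝ x₁ v = 0)
    {η lam : ℝ} (hη : 0 < η) (hlam : 0 < lam) (hx1 : η * lam ≤ 0.1)
    {x₀ : EuclideanSpace ℝ (Fin d)} (hx₀ : x₀ ≠ 0) (s : ℕ → Γ) {t₁ T : ℕ} (hT : t₁ < T)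
    {h r : ℝ} (hh : h = 2 * Real.sqrt (η * lam) / ((1 - η * lam) * σmin)) (hr : 0 ≤ r)
    (hnorm : ∀ t, t₁ ≤ t → t < T →
      η * σmin ^ 2 / (4 * lam) ≤ ‖sgdIterate ℓ η lam x₀ s t‖ ^ 4 ∧
      ‖sgdIterate ℓ η lam x₀ s t‖ ^ 4 ≤ η * σmax ^ 2 / lam)
    (hlin : ∑ t ∈ Finset.range T,
        (linTerm (expectedLoss ν ℓ) ℓ η (1 - η * lam) (η * σmin ^ 2 / (4 * lam)) t₁ t
            (sgdIterate ℓ η lam x₀ s t, s t)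
          - ∫ g, linTerm (expectedLoss ν ℓ) ℓ η (1 - η * lam) (η * σmin ^ 2 / (4 * lam)) t₁ t
            (sgdIterate ℓ η lam x₀ s t, g) ∂ν)
      ≤ Real.sqrt (r / 2 * (((T : ℝ) - t₁) *
          (2 * (h * (hessianBound (expectedLoss ν ℓ) * Real.pi * maxGradNorm ℓ))) ^ 2)))
    (hquad : ∑ t ∈ Finset.range T,
        (quadTerm (hessianBound (expectedLoss ν ℓ)) ℓ η (1 - η * lam)
            (η * σmin ^ 2 / (4 * lam)) t₁ t (sgdIterate ℓ η lam x₀ s t, s t)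
          - ∫ g, quadTerm (hessianBound (expectedLoss ν ℓ)) ℓ η (1 - η * lam)
            (η * σmin ^ 2 / (4 * lam)) t₁ t (sgdIterate ℓ η lam x₀ s t, g) ∂ν)
      ≤ Real.sqrt (r / 2 * (((T : ℝ) - t₁) *
          (hessianBound (expectedLoss ν ℓ) / 2 * h ^ 2 * maxGradNorm ℓ ^ 2) ^ 2))) :
    1 / ((T : ℝ) - t₁) * ∑ t ∈ Finset.Icc t₁ (T - 1),
        ‖gradient (expectedLoss ν ℓ) (direction (sgdIterate ℓ η lam x₀ s t))‖ ^ 2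
      ≤ Real.pi ^ 2 * hessianBound (expectedLoss ν ℓ) * σmax
          / (((T : ℝ) - t₁) * (Real.sqrt 2 * Real.sqrt (η * lam)))
        + 4 * Real.sqrt (η * lam) * (hessianBound (expectedLoss ν ℓ) * σmax ^ 3 / σmin ^ 2)
        + Real.sqrt (r / ((T : ℝ) - t₁))
          * (4 * (Real.pi * hessianBound (expectedLoss ν ℓ) * maxGradNorm ℓ * σmax / σmin))
        + Real.sqrt (r / ((T : ℝ) - t₁)) * (4 * Real.sqrt (η * lam)
          * (maxGradNorm ℓ ^ 2 * hessianBound (expectedLoss ν ℓ) * σmax / σmin ^ 2)) := by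
  have hx : 0 < η * lam := mul_pos hη hlam
  have hx1' : η * lam ≤ 1 / 10 := by norm_num at hx1; linarith
  have ha : 0 < 1 - η * lam := by linarith
  set a := 1 - η * lam with ha_def
  set B := η * σmin ^ 2 / (4 * lam) with hB
  set L := expectedLoss ν ℓ with hL_def
  set ρ := hessianBound L with hρ_def
  set X := sgdIterate ℓ η lam x₀ s with hX
  have hρ : 0 ≤ ρ := hessianBound_nonneg
  have hLinv : IsScaleInvariant L := IsScaleInvariant.expectedLoss hℓ_inv
  have hX0 : ∀ t, X t ≠ 0 := sgdIterate_ne_zero hℓ_diff hℓ_inv ha hx₀ s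
  have hhle : ∀ x : EuclideanSpace ℝ (Fin d), stepWeight η a B x ≤ h := fun x => by
    rw [hh]; exact stepWeight_le hη hlam ha hσmin_pos
  -- Telescoping. On this path the norm exceeds the threshold from `t₁` on, so the truncated weights
  -- are the true ones.
  have hdesc : ∀ n, t₁ ≤ n → n ≤ T → L (direction (X n)) ≤ L (direction (X t₁))
      + ∑ t ∈ Finset.range n, (linTerm L ℓ η a B t₁ t (X t, s t)
        + quadTerm ρ ℓ η a B t₁ t (X t, s t)) := by
    intro n hn
    induction n, hn using Nat.le_induction with
    | base =>
      intro _
      rw [Finset.sum_eq_zero fun t ht => ?_, add_zero]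
      have := Finset.mem_range.1 ht
      rw [linTerm, quadTerm, if_neg (by omega), if_neg (by omega), add_zero]
    | succ n hn ih =>
      intro hnT
      have h1 := (hℓ_inv (s n)).descent_step (hX0 n) (hℓ_diff (s n)) hLinv hL ha
      rw [Finset.sum_range_succ, linTerm, quadTerm, if_pos hn, if_pos hn,
        sphereGrad_of_ne_zero (hX0 n), stepWeight_of_le (hnorm n hn (by omega)).1]
      have h2 := ih (by omega)
      have h3 : X (n + 1) = (1 - η * lam) • X n - η • gradient (ℓ (s n)) (X n) := rfl
      rw [h3]
      linarith
  have hosc : L (direction (X t₁)) - L (direction (X T)) ≤ ρ / 2 * Real.pi ^ 2 :=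
    hLinv.sub_le hL hx₁ hv hx₁v (norm_direction (hX0 t₁)) (norm_direction (hX0 T))
  have hdT := hdesc T hT.le le_rfl
  rw [Finset.sum_add_distrib] at hdT
  rw [Finset.sum_sub_distrib] at hlin hquad
  have hIlin : ∑ t ∈ Finset.range T, ∫ g, linTerm L ℓ η a B t₁ t (X t, g) ∂ν
      ≤ -(Real.sqrt (η * lam) / (a * (Real.sqrt 2 * σmax)) *
        ∑ t ∈ Finset.Icc t₁ (T - 1), ‖gradient L (direction (X t))‖ ^ 2) := by
    rw [Finset.mul_sum, ← Finset.sum_neg_distrib, ← sum_range_ite_le _ hT]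
    refine Finset.sum_le_sum fun t ht => ?_
    rw [integral_linTerm hℓ_meas hℓ_int hℓ_diff hℓ_inv hℓ_bdd (hX0 t)]
    split_ifs with htt
    · obtain ⟨hlo, hhi⟩ := hnorm t htt (Finset.mem_range.1 ht)
      rw [stepWeight_of_le hlo]
      exact neg_le_neg (mul_le_mul_of_nonneg_right
        (le_effective_rate hη hlam ha hσmax_pos (hX0 t) hhi) (sq_nonneg _))
    · exact le_rfl
  have hIquad : ∑ t ∈ Finset.range T, ∫ g, quadTerm ρ ℓ η a B t₁ t (X t, g) ∂ν
      ≤ ((T : ℝ) - t₁) * (ρ / 2 * h ^ 2 * σmax ^ 2) := by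
    rw [← sum_range_ite_le_const _ hT]
    exact Finset.sum_le_sum fun t _ =>
      integral_quadTerm_le hη ha hρ hσmax hhle (hX0 t)
  refine average_le (a := a) (h := h) ?_ (by linarith) (Real.sqrt_pos.2 hx) hσmin_pos hσmax_pos hρ
    hr (sub_pos.2 (by exact_mod_cast hT)) maxGradNorm_nonneg hh ?_
  · norm_num; linarith
  · linarith

end Path

/-! ### Probabilities of the bad events -/

theorem eight_le_log {T δ : ℝ} (hT : 21 ≤ T) (hδ : 0 < δ) (hδ1 : δ < 1 / 5) :
    8 ≤ Real.log (2 * T ^ 2 / δ) := by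
  rw [Real.le_log_iff_exp_le (by positivity), le_div_iff₀ hδ]
  have h1 : Real.exp 8 ≤ 3000 := by
    calc Real.exp 8 = Real.exp 1 ^ 8 := by rw [← Real.exp_nat_mul]; norm_num
      _ ≤ 2.7182818286 ^ 8 := by gcongr; exact Real.exp_one_lt_d9.le
      _ ≤ 3000 := by norm_num
  nlinarith

theorem one_sub_le_measureReal {Ω : Type*} [MeasurableSpace Ω] {P : Measure Ω}
    [IsProbabilityMeasure P] {bad good : Set Ω} {c : ℝ} (hbad : P.real bad ≤ c)
    (h : ∀ ω, ω ∉ bad → ω ∈ good) : 1 - c ≤ P.real good := by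
  have h1 : P.real Set.univ ≤ P.real (bad ∪ good) :=
    measureReal_mono fun ω _ => or_iff_not_imp_left.2 (h ω)
  rw [probReal_univ] at h1
  linarith [measureReal_union_le (μ := P) bad good]

/-- The step may be altered at the origin to be jointly measurable, since the iterates never vanish.
-/
theorem exists_measurable_step {d : ℕ} {Γ : Type*} [MeasurableSpace Γ]
    {ℓ : Γ → EuclideanSpace ℝ (Fin d) → ℝ} (hℓ_meas : ∀ x, x ≠ 0 → Measurable (fun g => ℓ g x))
    (hℓ_diff : ∀ g x, x ≠ 0 → DifferentiableAt ℝ (ℓ g) x) (η lam : ℝ) :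
    ∃ step : EuclideanSpace ℝ (Fin d) × Γ → EuclideanSpace ℝ (Fin d), Measurable step ∧
      ∀ x g, x ≠ 0 → step (x, g) = (1 - η * lam) • x - η • gradient (ℓ g) x := by
  classical
  have h1 : Measurable fun p : EuclideanSpace ℝ (Fin d) × Γ => (1 - η * lam) • p.1 := by
    fun_prop
  have h2 := (measurable_gradient hℓ_meas hℓ_diff).const_smul η
  exact ⟨_, h1.sub h2, fun x g hx => by simp [hx]⟩

section Deviations

variable {d : ℕ} {Γ : Type*} [MeasurableSpace Γ] {ν : Measure Γ} [IsProbabilityMeasure ν]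
  {Ω : Type*} [MeasurableSpace Ω] {P : Measure Ω} [IsProbabilityMeasure P]
  {ℓ : Γ → EuclideanSpace ℝ (Fin d) → ℝ} {γ : ℕ → Ω → Γ}
  {step : EuclideanSpace ℝ (Fin d) × Γ → EuclideanSpace ℝ (Fin d)}
  {X : ℕ → Ω → EuclideanSpace ℝ (Fin d)} {x₀ : EuclideanSpace ℝ (Fin d)}

/-- The weights depend on the horizon `n`, so each `n` needs its own application of the tail bound;
the union over `n` follows later. -/
theorem measure_norm_deviation_le (hγ_meas : ∀ t, Measurable (γ t))
    (hγ_law : ∀ t, P.map (γ t) = ν) (hγ_indep : iIndepFun γ P) (hstep : Measurable step)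
    (hX0 : ∀ ω, X 0 ω = x₀) (hX : ∀ t ω, X (t + 1) ω = step (X t ω, γ t ω))
    (hG : Measurable (sphereGrad ℓ)) (hℓ_bdd : BddAbove (Set.range (sphereGradNorm ℓ)))
    {x s r : ℝ} (hx : 0 < x) (hx1 : x ≤ 0.1) (hs : 0 < s) (hr : 0 ≤ r)
    (hcond : 9 * x * r * (maxGradNorm ℓ ^ 2) ^ 2 ≤ s ^ 2) (n : ℕ) :
    P.real {ω | s / (12 * (1 - x) ^ 2 * x) < |∑ t ∈ Finset.range n,
        (((1 - x) ^ 4) ^ (n - 1 - t) * ‖sphereGrad ℓ (X t ω, γ t ω)‖ ^ 2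
        - ∫ g, ((1 - x) ^ 4) ^ (n - 1 - t) * ‖sphereGrad ℓ (X t ω, g)‖ ^ 2 ∂ν)|}
      ≤ 2 * Real.exp (-r) := by
  have h1 := measure_sqrt_lt_abs_sum_le hγ_meas hγ_law hγ_indep hstep hX0 hX
    (φ := fun t p => ((1 - x) ^ 4) ^ (n - 1 - t) * ‖sphereGrad ℓ p‖ ^ 2)
    (fun t => (hG.norm.pow_const 2).const_mul _)
    (lo := fun _ => 0) (hi := fun t => ((1 - x) ^ 4) ^ (n - 1 - t) * maxGradNorm ℓ ^ 2)
    (fun t p => ⟨by positivity, by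
      gcongr
      exact norm_sphereGrad_le hℓ_bdd p⟩) n hr
  refine le_trans (measureReal_mono fun ω hω => ?_) h1
  exact lt_of_le_of_lt (sqrt_deviation_le hx hx1 hs hr hcond n) hω

variable {L : EuclideanSpace ℝ (Fin d) → ℝ} {η a B h r : ℝ} {t₁ T : ℕ}

theorem measure_linTerm_deviation_le (hγ_meas : ∀ t, Measurable (γ t))
    (hγ_law : ∀ t, P.map (γ t) = ν) (hγ_indep : iIndepFun γ P) (hstep : Measurable step)
    (hX0 : ∀ ω, X 0 ω = x₀) (hX : ∀ t ω, X (t + 1) ω = step (X t ω, γ t ω))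
    (hG : Measurable (sphereGrad ℓ)) (hℓ_bdd : BddAbove (Set.range (sphereGradNorm ℓ)))
    (hη : 0 < η) (ha : 0 < a) (hL : IsScaleInvariant L) (hL2 : ContDiffOn ℝ 2 L {0}ᶜ)
    (hh : ∀ x : EuclideanSpace ℝ (Fin d), stepWeight η a B x ≤ h) (hT : t₁ < T) (hr : 0 ≤ r) :
    P.real {ω | Real.sqrt (r / 2 * (((T : ℝ) - t₁) *
          (2 * (h * (hessianBound L * Real.pi * maxGradNorm ℓ))) ^ 2))
        < ∑ t ∈ Finset.range T, (linTerm L ℓ η a B t₁ t (X t ω, γ t ω)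
          - ∫ g, linTerm L ℓ η a B t₁ t (X t ω, g) ∂ν)} ≤ Real.exp (-r) := by
  rw [← sum_range_ite_le_const _ hT]
  have h1 := measure_sqrt_lt_sum_le hγ_meas hγ_law hγ_indep hstep hX0 hX
    (φ := fun t => linTerm L ℓ η a B t₁ t) (fun t => measurable_linTerm hG)
    (fun t p => linTerm_mem_Icc hη ha hℓ_bdd hL hL2 hh p) T hr
  convert! h1 using 8 with ω t
  split_ifs <;> ring

theorem measure_quadTerm_deviation_le (hγ_meas : ∀ t, Measurable (γ t))
    (hγ_law : ∀ t, P.map (γ t) = ν) (hγ_indep : iIndepFun γ P) (hstep : Measurable step)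
    (hX0 : ∀ ω, X 0 ω = x₀) (hX : ∀ t ω, X (t + 1) ω = step (X t ω, γ t ω))
    (hG : Measurable (sphereGrad ℓ)) (hℓ_bdd : BddAbove (Set.range (sphereGradNorm ℓ)))
    (hη : 0 < η) (ha : 0 < a) {ρ : ℝ} (hρ : 0 ≤ ρ)
    (hh : ∀ x : EuclideanSpace ℝ (Fin d), stepWeight η a B x ≤ h) (hT : t₁ < T) (hr : 0 ≤ r) :
    P.real {ω | Real.sqrt (r / 2 * (((T : ℝ) - t₁) * (ρ / 2 * h ^ 2 * maxGradNorm ℓ ^ 2) ^ 2))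
        < ∑ t ∈ Finset.range T, (quadTerm ρ ℓ η a B t₁ t (X t ω, γ t ω)
          - ∫ g, quadTerm ρ ℓ η a B t₁ t (X t ω, g) ∂ν)} ≤ Real.exp (-r) := by
  rw [← sum_range_ite_le_const _ hT]
  have h1 := measure_sqrt_lt_sum_le hγ_meas hγ_law hγ_indep hstep hX0 hX
    (φ := fun t => quadTerm ρ ℓ η a B t₁ t) (fun t => measurable_quadTerm hG)
    (fun t p => quadTerm_mem_Icc hη ha hρ hℓ_bdd hh p) T hr
  convert! h1 using 8 with ω t
  split_ifs <;> ring

end Deviations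

end SGDWD

/-! ### The main theorem -/

theorem theorem4p2 {d : ℕ}
    {Γ : Type*} [MeasurableSpace Γ] (ν : Measure Γ) [IsProbabilityMeasure ν]
    {Ω : Type*} [MeasurableSpace Ω] (P : Measure Ω) [IsProbabilityMeasure P]
    -- the stochastic losses
    (ℓ : Γ → EuclideanSpace ℝ (Fin d) → ℝ)
    (hℓ_meas : ∀ x, x ≠ 0 → Measurable (fun g => ℓ g x))
    (hℓ_int : ∀ x, x ≠ 0 → Integrable (fun g => ℓ g x) ν)
    (hℓ_diff : ∀ g x, x ≠ 0 → DifferentiableAt ℝ (ℓ g) x)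
    (hℓ_inv : ∀ g, SGDWD.IsScaleInvariant (ℓ g))
    (hℓ_bdd : BddAbove (Set.range (SGDWD.sphereGradNorm ℓ)))
    (hL : ContDiffOn ℝ 2 (SGDWD.expectedLoss ν ℓ) {0}ᶜ)
    -- bounds on the expected squared gradient norm on the unit sphere
    (σmin σmax : ℝ) (hσmin_nonneg : 0 ≤ σmin) (hσmax_nonneg : 0 ≤ σmax)
    (hσmin : ∀ x : EuclideanSpace ℝ (Fin d), ‖x‖ = 1 →
      σmin ^ 2 ≤ ∫ g, ‖gradient (ℓ g) x‖ ^ 2 ∂ν)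
    (hσmax : ∀ x : EuclideanSpace ℝ (Fin d), ‖x‖ = 1 →
      ∫ g, ‖gradient (ℓ g) x‖ ^ 2 ∂ν ≤ σmax ^ 2)
    -- the i.i.d. samples
    (γ : ℕ → Ω → Γ) (hγ_meas : ∀ t, Measurable (γ t))
    (hγ_law : ∀ t, P.map (γ t) = ν) (hγ_indep : iIndepFun γ P)
    -- hyperparameters and initialization
    (η lam : ℝ) (hη : 0 < η) (hlam : 0 < lam) (hηlam : η * lam ≤ 0.1)
    (x₀ : EuclideanSpace ℝ (Fin d)) (hx₀ : x₀ ≠ 0)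
    (δ : ℝ) (hδ : 0 < δ)
    (M : ℝ) (hM : M = SGDWD.maxGradNorm ℓ)
    (ρ : ℝ) (hρ : ρ = SGDWD.hessianBound (SGDWD.expectedLoss ν ℓ))
    (T₁ : ℕ) (hT₁ : T₁ = SGDWD.burnIn η lam M σmax ‖x₀‖)
    (T : ℕ) (hT : T₁ < T)
    (hcond : 3 * Real.exp (4 * (η * lam))
        * Real.sqrt (lam * η * Real.log (2 * (T : ℝ) ^ 2 / δ)) ≤ σmin ^ 2 / M ^ 2)
    -- the iterates
    (X : ℕ → Ω → EuclideanSpace ℝ (Fin d))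
    (hX : ∀ t ω, X t ω = SGDWD.sgdIterate ℓ η lam x₀ (fun i => γ i ω) t) :
    1 - 5 * δ ≤ P.real {ω |
      (∀ t : ℕ, T₁ ≤ t → t ≤ T - 1 →
        σmin ^ 2 / 2 ≤ 2 * lam / η * ‖X t ω‖ ^ 4 ∧
        2 * lam / η * ‖X t ω‖ ^ 4 ≤ 4 * σmax ^ 2) ∧
      1 / ((T : ℝ) - T₁) * ∑ t ∈ Finset.Icc T₁ (T - 1),
          ‖gradient (SGDWD.expectedLoss ν ℓ) (SGDWD.direction (X t ω))‖ ^ 2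
        ≤ Real.pi ^ 2 * ρ * σmax / (((T : ℝ) - T₁) * Real.sqrt (2 * (η * lam)))
          + 4 * Real.sqrt (η * lam) * (ρ * σmax ^ 3 / σmin ^ 2)
          + Real.sqrt (Real.log (2 / δ) / ((T : ℝ) - T₁)) * (4 * (Real.pi * ρ * M * σmax / σmin))
          + Real.sqrt (Real.log (2 / δ) / ((T : ℝ) - T₁))
              * (4 * Real.sqrt (lam * η) * (M ^ 2 * ρ * σmax / σmin ^ 2))} := by
  -- For `δ ≥ 1/5` the claimed probability is not positive.
  rcases le_or_gt (1 / 5) δ with hδ5 | hδ5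
  · exact le_trans (by linarith) measureReal_nonneg
  have hx : 0 < η * lam := mul_pos hη hlam
  have hx1' : η * lam ≤ 1 / 10 := by norm_num at hηlam; linarith
  have ha : 0 < 1 - η * lam := by linarith
  have hT20 : (21 : ℝ) ≤ T := by
    have h1 := SGDWD.two_le_mul_burnIn (M := M) (σ := σmax) (r := ‖x₀‖) hx
    rw [← hT₁] at h1
    have h2 : (20 : ℝ) ≤ T₁ := by
      have : η * lam * T₁ ≤ 1 / 10 * T₁ := by gcongr
      linarith
    have h3 : (T₁ : ℝ) + 1 ≤ T := by exact_mod_cast hT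
    linarith
  set r := Real.log (2 * (T : ℝ) ^ 2 / δ) with hr_def
  have hr : 8 ≤ r := SGDWD.eight_le_log hT20 hδ hδ5
  have hdir : ‖SGDWD.direction x₀‖ = 1 := SGDWD.norm_direction hx₀
  have hdir0 : SGDWD.direction x₀ ≠ 0 := SGDWD.direction_ne_zero hx₀
  have hM0 : 0 ≤ M := hM ▸ SGDWD.maxGradNorm_nonneg
  -- If `M = 0`, the quotient `σmin² / M²` is `0` by convention, contradicting `hcond`.
  have hMpos : 0 < M := by
    refine lt_of_le_of_ne hM0 fun h0 => ?_
    rw [← h0, zero_pow two_ne_zero, div_zero] at hcond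
    have : 0 < Real.sqrt (lam * η * r) := Real.sqrt_pos.2 (by positivity)
    exact absurd hcond (not_le.2 (by positivity))
  have hGle : ∀ (g : Γ) (y : EuclideanSpace ℝ (Fin d)), ‖y‖ = 1 →
      ‖gradient (ℓ g) y‖ ^ 2 ≤ M ^ 2 := fun g y hy => by
    have := SGDWD.norm_gradient_le_maxGradNorm hℓ_bdd g hy
    rw [← hM] at this
    gcongr
  have hsQ : σmin ^ 2 ≤ M ^ 2 := by
    refine (hσmin _ hdir).trans ?_
    have h1 : ∫ g, ‖gradient (ℓ g) (SGDWD.direction x₀)‖ ^ 2 ∂ν ≤ ∫ _, M ^ 2 ∂ν :=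
      integral_mono_of_nonneg (Filter.Eventually.of_forall fun g => sq_nonneg _)
        (integrable_const _) (Filter.Eventually.of_forall fun g => hGle g _ hdir)
    simpa using h1
  obtain ⟨hs, hdevcond, hMσ⟩ := SGDWD.noise_condition hx (pow_pos hMpos 2) hr hsQ
    (by rwa [mul_comm lam η] at hcond)
  have hσmin_pos : 0 < σmin := lt_of_le_of_ne hσmin_nonneg fun h0 => by
    rw [← h0] at hs; norm_num at hs
  have hσle : σmin ≤ σmax :=
    le_of_sq_le_sq ((hσmin _ hdir).trans (hσmax _ hdir)) hσmax_nonneg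
  have hσmax_pos : 0 < σmax := hσmin_pos.trans_le hσle
  -- A nonzero gradient exists since its second moment is positive; being orthogonal to the point,
  -- it certifies `d ≥ 2`.
  obtain ⟨g₁, hg₁⟩ : ∃ g, gradient (ℓ g) (SGDWD.direction x₀) ≠ 0 := by
    by_contra! hall
    have h1 := hσmin _ hdir
    simp only [hall, norm_zero, zero_pow two_ne_zero, integral_zero] at h1
    exact absurd h1 (not_le.2 hs)
  have hg₁' : inner ℝ (SGDWD.direction x₀) (gradient (ℓ g₁) (SGDWD.direction x₀)) = 0 := by
    rw [real_inner_comm]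
    exact (hℓ_inv g₁).inner_gradient_self hdir0 (hℓ_diff _ _ hdir0)
  have hG : Measurable (SGDWD.sphereGrad ℓ) := SGDWD.measurable_sphereGrad hℓ_meas hℓ_diff
  have hXne : ∀ t ω, X t ω ≠ 0 := fun t ω => by
    rw [hX]; exact SGDWD.sgdIterate_ne_zero hℓ_diff hℓ_inv ha hx₀ _ t
  obtain ⟨step, hstep, hstep'⟩ := SGDWD.exists_measurable_step hℓ_meas hℓ_diff η lam
  have hXstep : ∀ t ω, X (t + 1) ω = step (X t ω, γ t ω) := fun t ω => by
    rw [hstep' _ _ (hXne t ω), hX, hX]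
    rfl
  have hX0 : ∀ ω, X 0 ω = x₀ := fun ω => hX 0 ω
  set a := 1 - η * lam with ha_def
  set B := η * σmin ^ 2 / (4 * lam) with hB
  set h := 2 * Real.sqrt (η * lam) / (a * σmin) with hh
  set L := SGDWD.expectedLoss ν ℓ with hL_def
  have hLinv : SGDWD.IsScaleInvariant L := SGDWD.IsScaleInvariant.expectedLoss hℓ_inv
  have hhle : ∀ x : EuclideanSpace ℝ (Fin d), SGDWD.stepWeight η a B x ≤ h :=
    fun x => SGDWD.stepWeight_le hη hlam ha hσmin_pos
  have hr₂ : 0 ≤ Real.log (2 / δ) := Real.log_nonneg (by rw [le_div_iff₀ hδ]; linarith)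
  have hT₀ : (0 : ℝ) < T := by linarith
  set dev : ℕ → Ω → ℝ := fun n ω => ∑ t ∈ Finset.range n,
    ((a ^ 4) ^ (n - 1 - t) * ‖SGDWD.sphereGrad ℓ (X t ω, γ t ω)‖ ^ 2
      - ∫ g, (a ^ 4) ^ (n - 1 - t) * ‖SGDWD.sphereGrad ℓ (X t ω, g)‖ ^ 2 ∂ν) with hdev_def
  set bad₁ : ℕ → Set Ω := fun n => {ω | σmin ^ 2 / (12 * a ^ 2 * (η * lam)) < |dev n ω|} with hbad₁
  have hbad₁_le : ∀ n, P.real (bad₁ n) ≤ δ / T ^ 2 := fun n => by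
    have h3 : 2 * Real.exp (-r) = δ / T ^ 2 := by
      rw [hr_def, Real.exp_neg, Real.exp_log (by positivity)]
      field_simp
    rw [← h3]
    exact SGDWD.measure_norm_deviation_le hγ_meas hγ_law hγ_indep hstep hX0 hXstep hG hℓ_bdd hx
      hηlam hs (by linarith) (by rw [← hM]; exact hdevcond) n
  have hexp₂ : Real.exp (-Real.log (2 / δ)) = δ / 2 := by
    rw [Real.exp_neg, Real.exp_log (by positivity), inv_div]
  have hbad₂_le := SGDWD.measure_linTerm_deviation_le (t₁ := T₁) (T := T) hγ_meas hγ_law hγ_indep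
    hstep hX0 hXstep hG hℓ_bdd hη ha hLinv hL hhle hT hr₂
  have hbad₃_le := SGDWD.measure_quadTerm_deviation_le (t₁ := T₁) (T := T) hγ_meas hγ_law hγ_indep
    hstep hX0 hXstep hG hℓ_bdd hη ha (SGDWD.hessianBound_nonneg (f := L)) hhle hT hr₂
  rw [hexp₂] at hbad₂_le hbad₃_le
  set bad₂ : Set Ω := {ω | _ < ∑ t ∈ Finset.range T, (SGDWD.linTerm L ℓ η a B T₁ t (X t ω, γ t ω)
    - ∫ g, SGDWD.linTerm L ℓ η a B T₁ t (X t ω, g) ∂ν)} with hbad₂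
  set bad₃ : Set Ω := {ω | _ < ∑ t ∈ Finset.range T,
    (SGDWD.quadTerm (SGDWD.hessianBound L) ℓ η a B T₁ t (X t ω, γ t ω)
    - ∫ g, SGDWD.quadTerm (SGDWD.hessianBound L) ℓ η a B T₁ t (X t ω, g) ∂ν)} with hbad₃
  set bad : Set Ω := (⋃ n ∈ Finset.range T, bad₁ n) ∪ (bad₂ ∪ bad₃) with hbad
  -- The norm events cost at most `T · δ / T² ≤ δ` and the other two `δ / 2` each, so `2δ` would
  -- already suffice.
  have hbad_le : P.real bad ≤ 5 * δ := by
    have h1 : P.real (⋃ n ∈ Finset.range T, bad₁ n) ≤ δ := by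
      refine (measureReal_biUnion_finset_le _ _).trans
        ((Finset.sum_le_sum fun n _ => hbad₁_le n).trans ?_)
      rw [Finset.sum_const, Finset.card_range, nsmul_eq_mul, mul_div_assoc', div_le_iff₀
        (by positivity)]
      nlinarith [mul_pos hδ hT₀]
    have h2 := measureReal_union_le (μ := P) (⋃ n ∈ Finset.range T, bad₁ n) (bad₂ ∪ bad₃)
    have h3 := measureReal_union_le (μ := P) bad₂ bad₃
    linarith
  refine SGDWD.one_sub_le_measureReal hbad_le fun ω hω => ?_
  have hω₁ : ∀ n < T, |dev n ω| ≤ σmin ^ 2 / (12 * a ^ 2 * (η * lam)) := fun n hn => by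
    by_contra hcon
    exact hω (Or.inl (Set.mem_biUnion (Finset.mem_coe.2 (Finset.mem_range.2 hn)) (not_le.1 hcon)))
  have hω₂ : ω ∉ bad₂ := fun hmem => hω (Or.inr (Or.inl hmem))
  have hω₃ : ω ∉ bad₃ := fun hmem => hω (Or.inr (Or.inr hmem))
  simp only [hbad₂, hbad₃, Set.mem_ofPred_eq, not_lt] at hω₂ hω₃
  have hrec := SGDWD.isNormRecursion_sgdIterate hℓ_diff hℓ_inv hℓ_bdd ha hx₀ (fun i => γ i ω)
  simp only [← hX, ← hM] at hrec
  have hbounds : ∀ t, T₁ ≤ t → t < T → B ≤ ‖X t ω‖ ^ 4 ∧ ‖X t ω‖ ^ 4 ≤ η * σmax ^ 2 / lam := by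
    intro t ht htT
    refine hrec.bounds (r := ‖x₀‖) (T := T)
      (m := fun t => ∫ g, ‖gradient (ℓ g) (SGDWD.direction (X t ω))‖ ^ 2 ∂ν)
      hη hlam hηlam hMpos hσmin_pos hσle hMσ
      (fun t => hσmin _ (SGDWD.norm_direction (hXne t ω)))
      (fun t => hσmax _ (SGDWD.norm_direction (hXne t ω)))
      (norm_pos_iff.2 hx₀) (by rw [hX0]) (fun n hn => ?_) htT (hT₁ ▸ ht)
    refine le_of_eq_of_le (congrArg _ ?_) (hω₁ n hn)
    refine Finset.sum_congr rfl fun i _ => ?_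
    simp only [SGDWD.sphereGrad_of_ne_zero (hXne i ω)]
    rw [integral_const_mul, mul_sub]
  rw [Set.mem_ofPred_eq]
  refine ⟨fun t ht htT => ?_, ?_⟩
  · obtain ⟨h1, h2⟩ := hbounds t ht (by omega)
    rw [hB, div_le_iff₀ (by positivity)] at h1
    rw [le_div_iff₀ hlam] at h2
    rw [div_mul_eq_mul_div, div_le_div_iff₀ two_pos hη, div_le_iff₀ hη]
    constructor
    · linarith
    · nlinarith [mul_pos hη (pow_pos hσmax_pos 2)]
  · have h1 := SGDWD.path_average_le hℓ_meas hℓ_int hℓ_diff hℓ_inv hℓ_bdd hL hσmin_pos hσmax_pos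
      hσmax hdir0 hg₁ hg₁' hη hlam hηlam hx₀ (fun i => γ i ω) hT hh hr₂
      (by simpa only [← hX] using hbounds) (by simpa only [← hX] using hω₂)
      (by simpa only [← hX] using hω₃)
    simp only [← hX] at h1
    rw [← hL_def, ← hρ, ← hM] at h1
    rw [Real.sqrt_mul two_pos.le (η * lam), mul_comm lam η]
    exact h1
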